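/- Let $\kappa\in\mathbb R$ and let $M_\kappa^2$ be the model surface of constant curvature $\kappa$ (a round sphere of radius $1/\sqrt\kappa$ if $\kappa>0$, the Euclidean plane if $\kappa=0$, the hyperbolic plane with metric rescaled by $1/\sqrt{-\kappa}$ if $\kappa<0$). A triangle is a nondegenerate labelled geodesic triangle $ABC$ in $M_\kappa^2$ (its vertices are not on one geodesic line and, if $\kappa>0$, lie in a common open hemisphere), with sides $a=BC$, $b=CA$, $c=AB$. Let $D,E,F$ be the midpoints of $BC,CA,AB$. The medial subdivision of $ABC$ consists of the four triangles $DEF$, $AFE$, $FBD$, $EDC$, whose vertices, in the order listed, are again labelled $A,B,C$ (so each side keeps the letter of the side containing it or, if there is none, of the side it is parallel to, i.e. does not meet). For $DEF$ and $AFE$ the new side $a$ is $EF$; we say that it is obtained as the parallel side of the old side $a$. A sequence $t_0,t_1,\dots$ of triangles is nested if $t_{n+1}$ is one of the four triangles of the medial subdivision of $t_n$ for every $n\ge 0$. Let $h_n$ be the height of $t_n$ from its vertex $A$, that is, the minimal distance from $A$ to the complete geodesic (great circle if $\kappa>0$) containing the side $a=BC$ of $t_n$. Then to each triangle $t_0$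 in $M_\kappa^2$ one can assign constants $l_h=l_h(t_0)>0$ and $L_h=L_h(t_0)>0$ such that: 1. for every nested sequence $t_0,t_1,\dots$ starting at $t_0$ and every $n\in\mathbb N$, $$h_0\cdot l_h\ \le\ 2^n h_n\ \le\ h_0\cdot L_h ;$$ 2. if moreover there is some $m\in\mathbb N$ for which the side $a$ of $t_{m+1}$ is obtained as the parallel side of the side $a$ of $t_m$, then both inequalities are strict for every $n\in\mathbb N$; 3. $l_h(t_0)\to1$ from below and $L_h(t_0)\to 1$ from above as all the side lengths of $t_0$ tend to $0$. -/

import Mathlib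

open Filter Topology

noncomputable section

namespace MedialSubdivision

/-- The bilinear form `x₀ y₀ + κ (x₁ y₁ + x₂ y₂)` on `ℝ³`. -/
def form (κ : ℝ) (x y : Fin 3 → ℝ) : ℝ :=
  x 0 * y 0 + κ * (x 1 * y 1 + x 2 * y 2)

/-- The model surface `M_κ²` of constant curvature `κ`: the quadric `x₀² + κ (x₁² + x₂²) = 1`,
restricted to the sheet `x₀ > 0` when `κ ≤ 0`.
* For `κ > 0` the map `x ↦ (x₀ / √κ, x₁, x₂)` identifies it with the round sphere of radius `1 / √κ`.
* For `κ = 0` it is the plane `x₀ = 1`.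
* For `κ < 0` the map `x ↦ (x₀, √(-κ) x₁, √(-κ) x₂)` identifies it with the hyperboloid model of
  the hyperbolic plane (with the metric rescaled by `1 / √(-κ)`). -/
def ModelPlane (κ : ℝ) : Type :=
  {x : Fin 3 → ℝ // form κ x x = 1 ∧ (κ ≤ 0 → 0 < x 0)}

variable {κ : ℝ}

/-- The underlying vector of `ℝ³`. -/
def ModelPlane.vec (p : ModelPlane κ) : Fin 3 → ℝ := p.1

/-- The geodesic distance of `M_κ²`: `cos (√κ d) = form κ p q` for `κ > 0`, the Euclidean distance
for `κ = 0`, and `cosh (√(-κ) d) = form κ p q` for `κ < 0`. -/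
def gdist (p q : ModelPlane κ) : ℝ :=
  if 0 < κ then Real.arccos (form κ p.vec q.vec) / √κ
  else if κ < 0 then Real.arcosh (form κ p.vec q.vec) / √(-κ)
  else √((p.vec 1 - q.vec 1) ^ 2 + (p.vec 2 - q.vec 2) ^ 2)

/-- `m` is a midpoint of the minimal geodesic segment from `p` to `q`. -/
def IsMidpoint (m p q : ModelPlane κ) : Prop :=
  gdist p m = gdist p q / 2 ∧ gdist m q = gdist p q / 2

/-- The complete geodesic (great circle for `κ > 0`) through two distinct, non-antipodal points:
the intersection of the surface with the linear plane that they span. -/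
def geodesicLine (p q : ModelPlane κ) : Set (ModelPlane κ) :=
  {x | x.vec ∈ Submodule.span ℝ {p.vec, q.vec}}

/-- The height of a point over a set: its minimal distance to the points of the set. -/
def heightOver (p : ModelPlane κ) (s : Set (ModelPlane κ)) : ℝ :=
  sInf (gdist p '' s)

/-- A labelled nondegenerate geodesic triangle `ABC`: the vertices do not lie on one geodesic line,
and for `κ > 0` they lie in a common open hemisphere. -/
structure Triangle (κ : ℝ) where
  A : ModelPlane κ
  B : ModelPlane κ
  C : ModelPlane κ
  nondegenerate : LinearIndependent ℝ ![A.vec, B.vec, C.vec]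
  hemisphere : 0 < κ → ∃ u : Fin 3 → ℝ, 0 < u ⬝ᵥ A.vec ∧ 0 < u ⬝ᵥ B.vec ∧ 0 < u ⬝ᵥ C.vec

namespace Triangle

/-- Length of the side `BC`, opposite `A`. -/
def a (T : Triangle κ) : ℝ := gdist T.B T.C

/-- Length of the side `CA`, opposite `B`. -/
def b (T : Triangle κ) : ℝ := gdist T.C T.A

/-- Length of the side `AB`, opposite `C`. -/
def c (T : Triangle κ) : ℝ := gdist T.A T.B

/-- The height from the vertex `A` onto the line prolonging the opposite side `BC`. -/
def height (T : Triangle κ) : ℝ := heightOver T.A (geodesicLine T.B T.C)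

/-- The largest side length. -/
def maxSide (T : Triangle κ) : ℝ := max T.a (max T.b T.c)

end Triangle

/-- The four triangles of the medial subdivision of `ABC`: the innermost one, and the outer ones
at the vertices `A`, `B`, `C`. -/
inductive Piece
  | inner
  | outerA
  | outerB
  | outerC

/-- `T` is the given triangle of the medial subdivision of `S`, labelled so that each side of `T`
carries the letter of the side of `S` that contains it or, if there is none, of the side of `S` to
which it is parallel, i.e. which it does not meet. Here `D`, `E`, `F` are the midpoints of the sides
`BC`, `CA`, `AB` of `S`. -/
def IsMedialPiece (k : Piece) (S T : Triangle κ) : Prop :=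
  ∃ D E F : ModelPlane κ,
    IsMidpoint D S.B S.C ∧ IsMidpoint E S.C S.A ∧ IsMidpoint F S.A S.B ∧
    match k with
    | .inner => T.A = D ∧ T.B = E ∧ T.C = F
    | .outerA => T.A = S.A ∧ T.B = F ∧ T.C = E
    | .outerB => T.A = F ∧ T.B = S.B ∧ T.C = D
    | .outerC => T.A = E ∧ T.B = D ∧ T.C = S.C

/-- A sequence of nested triangles: each one belongs to the medial subdivision of the previous. -/
def IsNested (t : ℕ → Triangle κ) : Prop :=
  ∀ n, ∃ k, IsMedialPiece k (t n) (t (n + 1))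

/-- The side `a` of `T` is obtained as the parallel side of the side `a` of `S`, i.e. it is the
segment joining the midpoints of the other two sides of `S`. -/
def ParallelSideA (S T : Triangle κ) : Prop :=
  IsMedialPiece .inner S T ∨ IsMedialPiece .outerA S T

/-- The filter on triangles describing "all the side lengths tend to `0`". -/
def sidesToZero (κ : ℝ) : Filter (Triangle κ) := comap Triangle.maxSide (𝓝 0)

end MedialSubdivision

end

/-!
The midpoint of `p` and `q` is `p + q` divided by twice the cosine of half their distance, so by
multilinearity of the triple determinant the squared sine of the height from `A` is multiplied by
an explicit factor when a triangle is replaced by a piece of its medial subdivision. Gram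
determinants bound this factor by powers of the numbers `cos² (s / 2)`, where `s` runs through the
sides. With the distortion of a triangle defined as the maximum of `|log cos² (s / 2)|`, this gives
`|log (2 ^ n * hₙ / h₀)| ≤ 3 ∑_{i ≤ n} distortion tᵢ`.

The sum is bounded in terms of `t₀` because distortions decay geometrically. For `κ ≤ 0` they are at
least halved in each step. For `κ > 0` project the sphere centrally to the tangent plane at the
centre of a hemisphere containing `t₀`. Geodesics become straight lines, and midpoints become points
that divide segments in ratios bounded away from `0` and `1`, so the diameters of the plane images
decay geometrically; distortions are quadratic in them.
-/

noncomputable section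

namespace MedialSubdivision

variable {κ : ℝ}

section Forms

/-- The symmetric bilinear form induced on bivectors, evaluated at `p ∧ q` and `r ∧ s` and divided
by `κ`: it is the polynomial in `κ` that equals
`(form κ p r * form κ q s - form κ p s * form κ q r) / κ` for `κ ≠ 0`. -/
def wedgeForm (κ : ℝ) (p q r s : Fin 3 → ℝ) : ℝ :=
  (p 0 * q 1 - p 1 * q 0) * (r 0 * s 1 - r 1 * s 0) +
    (p 0 * q 2 - p 2 * q 0) * (r 0 * s 2 - r 2 * s 0) +
    κ * ((p 1 * q 2 - p 2 * q 1) * (r 1 * s 2 - r 2 * s 1))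

/-- The square of a bivector `p ∧ q`. For two points of the surface at distance `d` it is
`(sin (√κ d) / √κ) ^ 2`, `d ^ 2` or `(sinh (√(-κ) d) / √(-κ)) ^ 2`, according to the sign of `κ`. -/
def wedgeSq (κ : ℝ) (p q : Fin 3 → ℝ) : ℝ := wedgeForm κ p q p q

/-- The determinant of three vectors of `ℝ³`. -/
def tripleDet (p q r : Fin 3 → ℝ) : ℝ := Matrix.det (Matrix.of ![p, q, r])

theorem tripleDet_eq (p q r : Fin 3 → ℝ) :
    tripleDet p q r = p 0 * q 1 * r 2 - p 0 * q 2 * r 1 - p 1 * q 0 * r 2 + p 1 * q 2 * r 0 +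
      p 2 * q 0 * r 1 - p 2 * q 1 * r 0 := by
  rw [tripleDet, Matrix.det_fin_three]
  simp

theorem form_comm (p q : Fin 3 → ℝ) : form κ p q = form κ q p := by
  simp only [form]; ring

theorem form_add_left (p q r : Fin 3 → ℝ) : form κ (p + q) r = form κ p r + form κ q r := by
  simp only [form, Pi.add_apply]; ring

theorem form_smul_left (c : ℝ) (p q : Fin 3 → ℝ) : form κ (c • p) q = c * form κ p q := by
  simp only [form, Pi.smul_apply, smul_eq_mul]; ring

theorem form_add_right (p q r : Fin 3 → ℝ) : form κ p (q + r) = form κ p q + form κ p r := by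
  simp only [form_comm p, form_add_left]

theorem form_smul_right (c : ℝ) (p q : Fin 3 → ℝ) : form κ p (c • q) = c * form κ p q := by
  simp only [form_comm p, form_smul_left]

theorem mul_wedgeSq (p q : Fin 3 → ℝ) :
    κ * wedgeSq κ p q = form κ p p * form κ q q - form κ p q ^ 2 := by
  simp only [wedgeSq, wedgeForm, form]; ring

theorem wedgeSq_comm (p q : Fin 3 → ℝ) : wedgeSq κ p q = wedgeSq κ q p := by
  simp only [wedgeSq, wedgeForm]; ring

theorem gram_eq_sq_mul_tripleDet_sq (p q r : Fin 3 → ℝ) :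
    form κ p p * form κ q q * form κ r r + 2 * form κ q r * form κ r p * form κ p q
      - form κ p p * form κ q r ^ 2 - form κ q q * form κ r p ^ 2 - form κ r r * form κ p q ^ 2 =
      κ ^ 2 * tripleDet p q r ^ 2 := by
  rw [tripleDet_eq]
  simp only [form]; ring

/-- The Gram determinant of the bivectors `p ∧ x` and `q ∧ r`; the vector on the right spans the
intersection of the planes that they determine. -/
theorem wedgeSq_mul_wedgeSq_sub (p x q r : Fin 3 → ℝ) :
    wedgeSq κ p x * wedgeSq κ q r - wedgeForm κ p x q r ^ 2 =
      form κ (tripleDet p q r • x - tripleDet x q r • p)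
        (tripleDet p q r • x - tripleDet x q r • p) := by
  simp only [tripleDet_eq, wedgeSq, wedgeForm, form, Pi.sub_apply, Pi.smul_apply, smul_eq_mul]
  ring

/-- The orthogonal projection of `p` to the plane of `q` and `r`, multiplied by `wedgeSq κ q r`. -/
def foot (κ : ℝ) (p q r : Fin 3 → ℝ) : Fin 3 → ℝ :=
  wedgeForm κ p r q r • q - wedgeForm κ p q q r • r

theorem form_foot (p q r : Fin 3 → ℝ) :
    form κ p (foot κ p q r) = form κ p p * wedgeSq κ q r - κ * tripleDet p q r ^ 2 := by
  rw [tripleDet_eq]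
  simp only [foot, wedgeSq, wedgeForm, form, Pi.sub_apply, Pi.smul_apply, smul_eq_mul]
  ring

theorem form_foot_self (p q r : Fin 3 → ℝ) :
    form κ (foot κ p q r) (foot κ p q r) = wedgeSq κ q r * form κ p (foot κ p q r) := by
  simp only [foot, wedgeSq, wedgeForm, form, Pi.sub_apply, Pi.smul_apply, smul_eq_mul]
  ring

theorem tripleDet_smul (a b c : ℝ) (p q r : Fin 3 → ℝ) :
    tripleDet (a • p) (b • q) (c • r) = a * b * c * tripleDet p q r := by
  simp only [tripleDet_eq, Pi.smul_apply, smul_eq_mul]; ring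

theorem wedgeSq_smul (b c : ℝ) (q r : Fin 3 → ℝ) :
    wedgeSq κ (b • q) (c • r) = (b * c) ^ 2 * wedgeSq κ q r := by
  simp only [wedgeSq, wedgeForm, Pi.smul_apply, smul_eq_mul]; ring

theorem wedgeForm_smul (c : ℝ) (p x q r : Fin 3 → ℝ) :
    wedgeForm κ p (c • x) q r = c * wedgeForm κ p x q r := by
  simp only [wedgeForm, Pi.smul_apply, smul_eq_mul]; ring

theorem wedgeForm_foot (p q r : Fin 3 → ℝ) : wedgeForm κ p (foot κ p q r) q r = 0 := by
  simp only [foot, wedgeForm, Pi.sub_apply, Pi.smul_apply, smul_eq_mul]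
  ring

/-- For points of the surface, the squared sine, in the trigonometry of curvature `κ`, of the
distance from `p` to the line through `q` and `r`. -/
def altitudeSq (κ : ℝ) (p q r : Fin 3 → ℝ) : ℝ := tripleDet p q r ^ 2 / wedgeSq κ q r

theorem altitudeSq_smul {b c : ℝ} (hb : b ≠ 0) (hc : c ≠ 0) (a : ℝ) (p q r : Fin 3 → ℝ) :
    altitudeSq κ (a • p) (b • q) (c • r) = a ^ 2 * altitudeSq κ p q r := by
  rw [altitudeSq, altitudeSq, tripleDet_smul, wedgeSq_smul]
  field_simp

end Forms

section Trigonometry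

theorem sinh_le_mul_cosh {t : ℝ} (ht : 0 < t) : Real.sinh t ≤ t * Real.cosh t := by
  obtain ⟨s, ⟨hs, hst⟩, h⟩ := exists_hasDerivAt_eq_slope Real.sinh Real.cosh ht
    Real.continuous_sinh.continuousOn fun x _ => Real.hasDerivAt_sinh x
  rw [Real.sinh_zero, sub_zero, sub_zero, eq_div_iff ht.ne', mul_comm] at h
  rw [← h]
  gcongr
  exact Real.cosh_le_cosh.2 (by rw [abs_of_pos hs, abs_of_pos ht]; exact hst.le)

theorem sin_div_self_mem_Icc {t : ℝ} (h0 : 0 < t) (hπ : t < Real.pi) :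
    Real.sin t / t ∈ Set.Icc ((1 + Real.cos t) / 2) 1 := by
  refine ⟨?_, (div_le_one h0).2 (Real.sin_le h0.le)⟩
  have hc : 0 < Real.cos (t / 2) :=
    Real.cos_pos_of_mem_Ioo ⟨by linarith [Real.pi_pos], by linarith⟩
  have htan := Real.le_tan (x := t / 2) (by linarith) (by linarith)
  rw [Real.tan_eq_sin_div_cos, le_div_iff₀ hc] at htan
  have hs := Real.sin_two_mul (t / 2)
  have hcos := Real.cos_sq (t / 2)
  rw [mul_div_cancel₀ t two_ne_zero] at hs hcos
  rw [le_div_iff₀ h0]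
  linear_combination 2 * Real.cos (t / 2) * htan - hs - t * hcos

theorem sinh_div_self_mem_Icc {t : ℝ} (ht : 0 < t) :
    Real.sinh t / t ∈ Set.Icc 1 ((1 + Real.cosh t) / 2) := by
  refine ⟨(one_le_div ht).2 (Real.self_le_sinh_iff.2 ht.le), ?_⟩
  have htanh := sinh_le_mul_cosh (half_pos ht)
  have hs := Real.sinh_two_mul (t / 2)
  have hcosh := Real.cosh_two_mul (t / 2)
  rw [mul_div_cancel₀ t two_ne_zero] at hs hcosh
  rw [div_le_iff₀ ht]
  linear_combination 2 * Real.cosh (t / 2) * htanh + hs - t / 2 * hcosh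
    + t / 2 * Real.cosh_sq_sub_sinh_sq (t / 2)

/-- The cosine of a side of length `t` in the trigonometry of constant curvature `κ`. -/
def modelCos (κ t : ℝ) : ℝ := if 0 < κ then Real.cos (√κ * t) else Real.cosh (√(-κ) * t)

/-- The sine of a side of length `t` in the trigonometry of constant curvature `κ`, normalized to
have derivative `1` at `0`. -/
def modelSin (κ t : ℝ) : ℝ :=
  if 0 < κ then Real.sin (√κ * t) / √κ
  else if κ < 0 then Real.sinh (√(-κ) * t) / √(-κ)
  else t

theorem modelCos_of_pos (hκ : 0 < κ) (t : ℝ) : modelCos κ t = Real.cos (√κ * t) := if_pos hκ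

theorem modelCos_of_neg (hκ : κ < 0) (t : ℝ) : modelCos κ t = Real.cosh (√(-κ) * t) :=
  if_neg hκ.not_gt

theorem modelCos_zero_left (t : ℝ) : modelCos 0 t = 1 := by simp [modelCos]

theorem modelSin_of_pos (hκ : 0 < κ) (t : ℝ) : modelSin κ t = Real.sin (√κ * t) / √κ := if_pos hκ

theorem modelSin_of_neg (hκ : κ < 0) (t : ℝ) : modelSin κ t = Real.sinh (√(-κ) * t) / √(-κ) := by
  rw [modelSin, if_neg hκ.not_gt, if_pos hκ]

theorem modelSin_zero_left (t : ℝ) : modelSin 0 t = t := by simp [modelSin]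

theorem modelCos_zero_right : modelCos κ 0 = 1 := by simp [modelCos]

theorem continuous_modelCos : Continuous (modelCos κ) := by
  unfold modelCos
  split_ifs <;> fun_prop

theorem mul_modelSin_sq (t : ℝ) : κ * modelSin κ t ^ 2 = 1 - modelCos κ t ^ 2 := by
  rcases lt_trichotomy κ 0 with hκ | rfl | hκ
  · rw [modelSin_of_neg hκ, modelCos_of_neg hκ, div_pow, Real.sq_sqrt (by linarith), Real.sinh_sq,
      ← mul_div_assoc, div_neg, mul_div_cancel_left₀ _ hκ.ne, neg_sub]
  · simp [modelCos_zero_left]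
  · rw [modelSin_of_pos hκ, modelCos_of_pos hκ, div_pow, Real.sq_sqrt hκ.le, Real.sin_sq]
    field_simp

theorem modelCos_half_sq (t : ℝ) : modelCos κ (t / 2) ^ 2 = (1 + modelCos κ t) / 2 := by
  unfold modelCos
  split_ifs
  · rw [Real.cos_sq, show 2 * (√κ * (t / 2)) = √κ * t by ring]
    ring
  · have h1 := Real.cosh_two_mul (√(-κ) * (t / 2))
    have h2 := Real.cosh_sq (√(-κ) * (t / 2))
    rw [show 2 * (√(-κ) * (t / 2)) = √(-κ) * t by ring] at h1
    linarith

theorem modelSin_div_self_mem_uIcc {t : ℝ} (ht : 0 < t) (hπ : 0 < κ → √κ * t < Real.pi) :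
    modelSin κ t / t ∈ Set.uIcc 1 ((1 + modelCos κ t) / 2) := by
  rcases lt_trichotomy κ 0 with hκ | rfl | hκ
  · rw [modelSin_of_neg hκ, modelCos_of_neg hκ, div_div]
    exact Set.Icc_subset_uIcc
      (sinh_div_self_mem_Icc (mul_pos (Real.sqrt_pos.2 (neg_pos.2 hκ)) ht))
  · rw [modelSin_zero_left, div_self ht.ne']
    exact Set.left_mem_uIcc
  · rw [modelSin_of_pos hκ, modelCos_of_pos hκ, div_div]
    exact Set.Icc_subset_uIcc'
      (sin_div_self_mem_Icc (mul_pos (Real.sqrt_pos.2 hκ) ht) (hπ hκ))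

end Trigonometry

section Distance

theorem ModelPlane.form_self (p : ModelPlane κ) : form κ p.vec p.vec = 1 := p.2.1

theorem ModelPlane.vec_zero_pos (hκ : κ ≤ 0) (p : ModelPlane κ) : 0 < p.vec 0 := p.2.2 hκ

theorem ModelPlane.vec_zero_eq_one (p : ModelPlane 0) : p.vec 0 = 1 := by
  have h := p.form_self
  simp only [form, zero_mul, add_zero] at h
  nlinarith [p.vec_zero_pos le_rfl]

theorem form_sq (p q : ModelPlane κ) :
    form κ p.vec q.vec ^ 2 = 1 - κ * wedgeSq κ p.vec q.vec := by
  rw [mul_wedgeSq, p.form_self, q.form_self]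
  ring

theorem wedgeSq_nonneg_of_nonneg (hκ : 0 ≤ κ) (p q : Fin 3 → ℝ) : 0 ≤ wedgeSq κ p q := by
  simp only [wedgeSq, wedgeForm, ← pow_two]
  positivity

theorem abs_form_le_one (hκ : 0 < κ) (p q : ModelPlane κ) : |form κ p.vec q.vec| ≤ 1 := by
  rw [← sq_le_one_iff_abs_le_one, form_sq]
  linarith [mul_nonneg hκ.le (wedgeSq_nonneg_of_nonneg hκ.le p.vec q.vec)]

theorem one_le_form (hκ : κ ≤ 0) (p q : ModelPlane κ) : 1 ≤ form κ p.vec q.vec := by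
  have hp := p.form_self
  have hq := q.form_self
  have hpq : 0 ≤ p.vec 0 * q.vec 0 := (mul_pos (p.vec_zero_pos hκ) (q.vec_zero_pos hκ)).le
  have hsq : (1 - κ * (p.vec 1 * q.vec 1 + p.vec 2 * q.vec 2)) ^ 2 ≤ (p.vec 0 * q.vec 0) ^ 2 := by
    have hdiff : (p.vec 0 * q.vec 0) ^ 2 =
        (1 - κ * (p.vec 1 ^ 2 + p.vec 2 ^ 2)) * (1 - κ * (q.vec 1 ^ 2 + q.vec 2 ^ 2)) := by
      simp only [form] at hp hq
      rw [mul_pow]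
      congr 1 <;> linarith
    have hd := mul_nonneg (neg_nonneg.2 hκ)
      (add_nonneg (sq_nonneg (p.vec 1 - q.vec 1)) (sq_nonneg (p.vec 2 - q.vec 2)))
    have hc := mul_nonneg (sq_nonneg κ) (sq_nonneg (p.vec 1 * q.vec 2 - p.vec 2 * q.vec 1))
    linarith
  have := abs_le_of_sq_le_sq' hsq hpq
  simp only [form]
  linarith

theorem neg_one_le_form (p q : ModelPlane κ) : -1 ≤ form κ p.vec q.vec := by
  rcases le_or_gt κ 0 with hκ | hκ
  · linarith [one_le_form hκ p q]
  · exact (abs_le.1 (abs_form_le_one hκ p q)).1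

theorem form_zero (p q : ModelPlane 0) : form 0 p.vec q.vec = 1 := by
  simp [form, ModelPlane.vec_zero_eq_one]

theorem wedgeSq_zero (p q : ModelPlane 0) :
    wedgeSq 0 p.vec q.vec = (p.vec 1 - q.vec 1) ^ 2 + (p.vec 2 - q.vec 2) ^ 2 := by
  simp only [wedgeSq, wedgeForm, ModelPlane.vec_zero_eq_one]
  ring

theorem gdist_of_pos (hκ : 0 < κ) (p q : ModelPlane κ) :
    gdist p q = Real.arccos (form κ p.vec q.vec) / √κ := if_pos hκ

theorem gdist_of_neg (hκ : κ < 0) (p q : ModelPlane κ) :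
    gdist p q = Real.arcosh (form κ p.vec q.vec) / √(-κ) := by
  rw [gdist, if_neg hκ.not_gt, if_pos hκ]

theorem gdist_zero_curvature (p q : ModelPlane 0) :
    gdist p q = √(wedgeSq 0 p.vec q.vec) := by
  simp [gdist, wedgeSq_zero]

theorem sqrt_mul_gdist (hκ : 0 < κ) (p q : ModelPlane κ) :
    √κ * gdist p q = Real.arccos (form κ p.vec q.vec) := by
  rw [gdist_of_pos hκ, mul_div_cancel₀ _ (Real.sqrt_pos.2 hκ).ne']

theorem modelCos_gdist (p q : ModelPlane κ) : modelCos κ (gdist p q) = form κ p.vec q.vec := by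
  rcases lt_trichotomy κ 0 with hκ | rfl | hκ
  · rw [modelCos_of_neg hκ, gdist_of_neg hκ,
      mul_div_cancel₀ _ (Real.sqrt_pos.2 (neg_pos.2 hκ)).ne',
      Real.cosh_arcosh (one_le_form hκ.le p q)]
  · rw [modelCos_zero_left, form_zero]
  · have h := abs_le.1 (abs_form_le_one hκ p q)
    rw [modelCos_of_pos hκ, sqrt_mul_gdist hκ, Real.cos_arccos h.1 h.2]

theorem modelSin_gdist_sq (p q : ModelPlane κ) :
    modelSin κ (gdist p q) ^ 2 = wedgeSq κ p.vec q.vec := by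
  rcases eq_or_ne κ 0 with rfl | hκ
  · rw [modelSin_zero_left, gdist_zero_curvature,
      Real.sq_sqrt (wedgeSq_nonneg_of_nonneg le_rfl _ _)]
  · refine mul_left_cancel₀ hκ ?_
    rw [mul_modelSin_sq, modelCos_gdist, form_sq]
    ring

theorem wedgeSq_nonneg (p q : ModelPlane κ) : 0 ≤ wedgeSq κ p.vec q.vec := by
  rw [← modelSin_gdist_sq]
  positivity

theorem gdist_nonneg (p q : ModelPlane κ) : 0 ≤ gdist p q := by
  rcases lt_trichotomy κ 0 with hκ | rfl | hκ
  · rw [gdist_of_neg hκ]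
    exact div_nonneg (Real.arcosh_nonneg (one_le_form hκ.le p q)) (Real.sqrt_nonneg _)
  · rw [gdist_zero_curvature]
    exact Real.sqrt_nonneg _
  · rw [gdist_of_pos hκ]
    exact div_nonneg (Real.arccos_nonneg _) (Real.sqrt_nonneg _)

theorem gdist_comm (p q : ModelPlane κ) : gdist p q = gdist q p := by
  rcases lt_trichotomy κ 0 with hκ | rfl | hκ
  · rw [gdist_of_neg hκ, gdist_of_neg hκ, form_comm]
  · rw [gdist_zero_curvature, gdist_zero_curvature, wedgeSq_comm]
  · rw [gdist_of_pos hκ, gdist_of_pos hκ, form_comm]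

theorem gdist_self (p : ModelPlane κ) : gdist p p = 0 := by
  have hw : wedgeSq κ p.vec p.vec = 0 := by simp only [wedgeSq, wedgeForm]; ring
  rcases lt_trichotomy κ 0 with hκ | rfl | hκ
  · rw [gdist_of_neg hκ, p.form_self, Real.arcosh_zero, zero_div]
  · rw [gdist_zero_curvature, hw, Real.sqrt_zero]
  · rw [gdist_of_pos hκ, p.form_self, Real.arccos_one, zero_div]

theorem gdist_le_gdist {p q r : ModelPlane κ} (hpq : 0 ≤ form κ p.vec q.vec)
    (h : wedgeSq κ p.vec q.vec ≤ wedgeSq κ p.vec r.vec) : gdist p q ≤ gdist p r := by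
  rcases lt_trichotomy κ 0 with hκ | rfl | hκ
  · rw [gdist_of_neg hκ, gdist_of_neg hκ]
    have hpr := one_le_form hκ.le p r
    have hle : form κ p.vec q.vec ≤ form κ p.vec r.vec := by
      refine le_of_sq_le_sq ?_ (by linarith)
      rw [form_sq, form_sq]
      linarith [mul_le_mul_of_nonpos_left h hκ.le]
    gcongr
    exact (Real.arcosh_le_arcosh (by linarith [one_le_form hκ.le p q]) (by linarith)).2 hle
  · rw [gdist_zero_curvature, gdist_zero_curvature]
    exact Real.sqrt_le_sqrt h
  · rw [gdist_of_pos hκ, gdist_of_pos hκ]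
    have hle : form κ p.vec r.vec ≤ form κ p.vec q.vec := by
      refine (abs_le_of_sq_le_sq' ?_ hpq).2
      rw [form_sq, form_sq]
      linarith [mul_le_mul_of_nonneg_left h hκ.le]
    gcongr

/-- The square of the cosine of half the distance, in the trigonometry of curvature `κ`. -/
def cosHalfSq (p q : ModelPlane κ) : ℝ := (1 + form κ p.vec q.vec) / 2

theorem cosHalfSq_comm (p q : ModelPlane κ) : cosHalfSq p q = cosHalfSq q p := by
  rw [cosHalfSq, cosHalfSq, form_comm]

theorem cosHalfSq_self (p : ModelPlane κ) : cosHalfSq p p = 1 := by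
  rw [cosHalfSq, p.form_self]; norm_num

theorem cosHalfSq_nonneg (p q : ModelPlane κ) : 0 ≤ cosHalfSq p q := by
  rw [cosHalfSq]; linarith [neg_one_le_form p q]

theorem modelCos_half_gdist_sq (p q : ModelPlane κ) :
    modelCos κ (gdist p q / 2) ^ 2 = cosHalfSq p q := by
  rw [modelCos_half_sq, modelCos_gdist, cosHalfSq]

end Distance

section Height

theorem zero_lt_of_form_pos (hκ : κ ≤ 0) (p : ModelPlane κ) {v : Fin 3 → ℝ}
    (hvv : 0 ≤ form κ v v) (hpv : 0 < form κ p.vec v) : 0 < v 0 := by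
  by_contra! hv
  have hp := p.form_self
  have hp0 := p.vec_zero_pos hκ
  simp only [form] at hvv hpv hp
  have hpv0 : p.vec 0 * v 0 ≤ 0 := mul_nonpos_of_nonneg_of_nonpos hp0.le hv
  have hlt : (p.vec 0 * v 0) ^ 2 < (κ * (p.vec 1 * v 1 + p.vec 2 * v 2)) ^ 2 :=
    sq_lt_sq.2 (by rw [abs_of_nonpos hpv0, abs_of_pos] <;> linarith)
  have hcauchy : (κ * (p.vec 1 * v 1 + p.vec 2 * v 2)) ^ 2 ≤
      (κ * (p.vec 1 ^ 2 + p.vec 2 ^ 2)) * (κ * (v 1 ^ 2 + v 2 ^ 2)) := by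
    linarith [mul_nonneg (sq_nonneg κ) (sq_nonneg (p.vec 1 * v 2 - p.vec 2 * v 1))]
  have hle : (κ * (p.vec 1 ^ 2 + p.vec 2 ^ 2)) * (κ * (v 1 ^ 2 + v 2 ^ 2)) ≤
      (κ * (p.vec 1 ^ 2 + p.vec 2 ^ 2)) * -v 0 ^ 2 :=
    mul_le_mul_of_nonpos_left (by linarith) (mul_nonpos_of_nonpos_of_nonneg hκ (by positivity))
  have hp1 : κ * (p.vec 1 ^ 2 + p.vec 2 ^ 2) = 1 - p.vec 0 ^ 2 := by linarith
  rw [hp1] at hle hcauchy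
  linarith [sq_nonneg (v 0)]

theorem tripleDet_sq_le_of_tripleDet_eq_zero (x : ModelPlane κ) (p : Fin 3 → ℝ) {q r : Fin 3 → ℝ}
    (hx : tripleDet x.vec q r = 0) :
    tripleDet p q r ^ 2 ≤ wedgeSq κ p x.vec * wedgeSq κ q r := by
  have h := wedgeSq_mul_wedgeSq_sub (κ := κ) p x.vec q r
  rw [hx, zero_smul, sub_zero, form_smul_left, form_smul_right, x.form_self] at h
  linarith [sq_nonneg (wedgeForm κ p x.vec q r)]

theorem tripleDet_eq_zero_of_mem_span {x q r : Fin 3 → ℝ}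
    (hx : x ∈ Submodule.span ℝ {q, r}) : tripleDet x q r = 0 := by
  obtain ⟨u, v, rfl⟩ := Submodule.mem_span_pair.1 hx
  simp only [tripleDet_eq, Pi.add_apply, Pi.smul_apply, smul_eq_mul]
  ring

theorem wedgeSq_mul_wedgeSq_of_wedgeForm_eq_zero (x : ModelPlane κ) {p q r : Fin 3 → ℝ}
    (hx : tripleDet x.vec q r = 0) (h0 : wedgeForm κ p x.vec q r = 0) :
    wedgeSq κ p x.vec * wedgeSq κ q r = tripleDet p q r ^ 2 := by
  have h := wedgeSq_mul_wedgeSq_sub (κ := κ) p x.vec q r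
  rw [hx, h0, zero_smul, sub_zero, form_smul_left, form_smul_right, x.form_self] at h
  linarith

theorem foot_mem_span (p q r : Fin 3 → ℝ) : foot κ p q r ∈ Submodule.span ℝ {q, r} :=
  Submodule.mem_span_pair.2 ⟨wedgeForm κ p r q r, -wedgeForm κ p q q r, by rw [foot]; module⟩

theorem form_foot_nonneg (p q r : ModelPlane κ) (hqr : 0 < wedgeSq κ q.vec r.vec) :
    0 ≤ form κ p.vec (foot κ p.vec q.vec r.vec) := by
  rcases le_or_gt κ 0 with hκ | hκ
  · rw [form_foot, p.form_self]
    linarith [mul_nonpos_of_nonpos_of_nonneg hκ (sq_nonneg (tripleDet p.vec q.vec r.vec))]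
  · refine nonneg_of_mul_nonneg_right ?_ hqr
    rw [← form_foot_self]
    simp only [form, ← pow_two]
    positivity

theorem exists_mem_geodesicLine_of_form_foot_pos {p q r : ModelPlane κ}
    (hqr : 0 < wedgeSq κ q.vec r.vec) (h : 0 < form κ p.vec (foot κ p.vec q.vec r.vec)) :
    ∃ x ∈ geodesicLine q r, 0 ≤ form κ p.vec x.vec ∧
      wedgeSq κ p.vec x.vec * wedgeSq κ q.vec r.vec = tripleDet p.vec q.vec r.vec ^ 2 := by
  set v := foot κ p.vec q.vec r.vec with hv
  have hvv : 0 < form κ v v := by rw [hv, form_foot_self]; exact mul_pos hqr h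
  have hc := inv_pos.2 (Real.sqrt_pos.2 hvv)
  have hunit : form κ ((√(form κ v v))⁻¹ • v) ((√(form κ v v))⁻¹ • v) = 1 := by
    rw [form_smul_left, form_smul_right, ← mul_assoc, ← pow_two, inv_pow, Real.sq_sqrt hvv.le,
      inv_mul_cancel₀ hvv.ne']
  let x : ModelPlane κ :=
    ⟨(√(form κ v v))⁻¹ • v, hunit, fun hκ => mul_pos hc (zero_lt_of_form_pos hκ p hvv.le h)⟩
  have hxline : x ∈ geodesicLine q r := Submodule.smul_mem _ _ (foot_mem_span _ _ _)
  have hpx : form κ p.vec x.vec = (√(form κ v v))⁻¹ * form κ p.vec v := form_smul_right _ _ _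
  have hwedge : wedgeForm κ p.vec x.vec q.vec r.vec = 0 := by
    rw [show x.vec = (√(form κ v v))⁻¹ • v from rfl, wedgeForm_smul, hv, wedgeForm_foot, mul_zero]
  exact ⟨x, hxline, hpx ▸ (mul_pos hc h).le,
    wedgeSq_mul_wedgeSq_of_wedgeForm_eq_zero x (tripleDet_eq_zero_of_mem_span hxline) hwedge⟩

theorem exists_mem_geodesicLine_wedgeSq_eq (p q r : ModelPlane κ)
    (hqr : 0 < wedgeSq κ q.vec r.vec) :
    ∃ x ∈ geodesicLine q r, 0 ≤ form κ p.vec x.vec ∧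
      wedgeSq κ p.vec x.vec * wedgeSq κ q.vec r.vec = tripleDet p.vec q.vec r.vec ^ 2 := by
  rcases (form_foot_nonneg p q r hqr).lt_or_eq with h | h
  · exact exists_mem_geodesicLine_of_form_foot_pos hqr h
  -- Otherwise `p` is a pole of the great circle, and all points of the circle are equally close.
  have hq : q ∈ geodesicLine q r := Submodule.subset_span (Set.mem_insert _ _)
  have hle := tripleDet_sq_le_of_tripleDet_eq_zero q p.vec (tripleDet_eq_zero_of_mem_span hq)
  rw [form_foot, p.form_self, one_mul] at h
  have hκ : 0 < κ := by
    by_contra! hκ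
    linarith [mul_nonpos_of_nonpos_of_nonneg hκ (sq_nonneg (tripleDet p.vec q.vec r.vec))]
  have hsq : form κ p.vec q.vec ^ 2 * wedgeSq κ q.vec r.vec =
      κ * (tripleDet p.vec q.vec r.vec ^ 2 - wedgeSq κ p.vec q.vec * wedgeSq κ q.vec r.vec) := by
    rw [form_sq]
    linarith
  have hform : form κ p.vec q.vec = 0 := by
    have := nonpos_of_mul_nonpos_left
      (hsq.trans_le (mul_nonpos_of_nonneg_of_nonpos hκ.le (sub_nonpos.2 hle))) hqr
    exact pow_eq_zero_iff two_ne_zero |>.1 (le_antisymm this (sq_nonneg _))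
  refine ⟨q, hq, hform.ge, ?_⟩
  rw [hform, zero_pow two_ne_zero, zero_mul] at hsq
  linarith [(mul_eq_zero.1 hsq.symm).resolve_left hκ.ne']

theorem cosHalfSq_pos {p q : ModelPlane κ} (h : 0 < wedgeSq κ p.vec q.vec) :
    0 < cosHalfSq p q := by
  refine (cosHalfSq_nonneg p q).lt_of_ne fun h0 => ?_
  have hform : form κ p.vec q.vec = -1 := by rw [cosHalfSq] at h0; linarith
  have hsq := form_sq p q
  have hκ : 0 < κ := by
    by_contra! hκ
    linarith [one_le_form hκ p q]
  rw [hform] at hsq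
  linarith [mul_pos hκ h]

namespace Triangle

/-- The determinant of the position vectors of the vertices. -/
def det (T : Triangle κ) : ℝ := tripleDet T.A.vec T.B.vec T.C.vec

theorem det_ne_zero (T : Triangle κ) : T.det ≠ 0 := by
  have h : LinearIndependent ℝ (Matrix.of ![T.A.vec, T.B.vec, T.C.vec]).row := T.nondegenerate
  rw [Matrix.linearIndependent_rows_iff_isUnit, Matrix.isUnit_iff_isUnit_det] at h
  exact h.ne_zero

theorem det_sq_pos (T : Triangle κ) : 0 < T.det ^ 2 := sq_pos_of_ne_zero T.det_ne_zero

theorem det_sq_le_mul_wedgeSq_AB (T : Triangle κ) :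
    T.det ^ 2 ≤ wedgeSq κ T.A.vec T.B.vec * wedgeSq κ T.B.vec T.C.vec :=
  tripleDet_sq_le_of_tripleDet_eq_zero T.B T.A.vec (by rw [tripleDet_eq]; ring)

theorem det_sq_le_mul_wedgeSq_AC (T : Triangle κ) :
    T.det ^ 2 ≤ wedgeSq κ T.A.vec T.C.vec * wedgeSq κ T.B.vec T.C.vec :=
  tripleDet_sq_le_of_tripleDet_eq_zero T.C T.A.vec (by rw [tripleDet_eq]; ring)

theorem wedgeSq_AB_pos (T : Triangle κ) : 0 < wedgeSq κ T.A.vec T.B.vec :=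
  pos_of_mul_pos_left (T.det_sq_pos.trans_le T.det_sq_le_mul_wedgeSq_AB) (wedgeSq_nonneg _ _)

theorem wedgeSq_BC_pos (T : Triangle κ) : 0 < wedgeSq κ T.B.vec T.C.vec :=
  pos_of_mul_pos_right (T.det_sq_pos.trans_le T.det_sq_le_mul_wedgeSq_AB) (wedgeSq_nonneg _ _)

theorem wedgeSq_CA_pos (T : Triangle κ) : 0 < wedgeSq κ T.C.vec T.A.vec :=
  wedgeSq_comm T.A.vec T.C.vec ▸
    pos_of_mul_pos_left (T.det_sq_pos.trans_le T.det_sq_le_mul_wedgeSq_AC) (wedgeSq_nonneg _ _)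

/-- The square of `modelSin κ T.height`. -/
def heightSq (T : Triangle κ) : ℝ := altitudeSq κ T.A.vec T.B.vec T.C.vec

theorem heightSq_pos (T : Triangle κ) : 0 < T.heightSq := div_pos T.det_sq_pos T.wedgeSq_BC_pos

theorem heightSq_le_wedgeSq (T : Triangle κ) {x : ModelPlane κ}
    (hx : x ∈ geodesicLine T.B T.C) : T.heightSq ≤ wedgeSq κ T.A.vec x.vec :=
  (div_le_iff₀ T.wedgeSq_BC_pos).2
    (tripleDet_sq_le_of_tripleDet_eq_zero x T.A.vec (tripleDet_eq_zero_of_mem_span hx))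

theorem exists_height_eq_gdist (T : Triangle κ) :
    ∃ x ∈ geodesicLine T.B T.C, T.height = gdist T.A x ∧ 0 ≤ form κ T.A.vec x.vec ∧
      wedgeSq κ T.A.vec x.vec = T.heightSq := by
  obtain ⟨x, hx, hAx, hwedge⟩ := exists_mem_geodesicLine_wedgeSq_eq T.A T.B T.C T.wedgeSq_BC_pos
  rw [← eq_div_iff T.wedgeSq_BC_pos.ne'] at hwedge
  refine ⟨x, hx, IsLeast.csInf_eq ⟨Set.mem_image_of_mem _ hx, ?_⟩, hAx, hwedge⟩
  rintro _ ⟨y, hy, rfl⟩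
  exact gdist_le_gdist hAx (hwedge.trans_le (T.heightSq_le_wedgeSq hy))

theorem modelSin_height_sq (T : Triangle κ) : modelSin κ T.height ^ 2 = T.heightSq := by
  obtain ⟨x, -, hheight, -, hwedge⟩ := T.exists_height_eq_gdist
  rw [hheight, modelSin_gdist_sq, hwedge]

theorem height_pos (T : Triangle κ) : 0 < T.height := by
  have hnonneg : 0 ≤ T.height := by
    obtain ⟨x, -, hheight, -⟩ := T.exists_height_eq_gdist
    exact hheight ▸ gdist_nonneg _ _
  refine hnonneg.lt_of_ne fun h => T.heightSq_pos.ne ?_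
  rw [← T.modelSin_height_sq, ← h]
  simp [modelSin]

theorem height_le_b (T : Triangle κ) : T.height ≤ T.b := by
  obtain ⟨x, -, hheight, hAx, hwedge⟩ := T.exists_height_eq_gdist
  have hC : T.C ∈ geodesicLine T.B T.C := Submodule.subset_span (by simp)
  rw [hheight, b, gdist_comm T.C]
  exact gdist_le_gdist hAx (hwedge.trans_le (T.heightSq_le_wedgeSq hC))

theorem maxSide_pos (T : Triangle κ) : 0 < T.maxSide :=
  T.height_pos.trans_le (T.height_le_b.trans ((le_max_left _ _).trans (le_max_right _ _)))

theorem sqrt_mul_height_lt_pi (hκ : 0 < κ) (T : Triangle κ) : √κ * T.height < Real.pi := by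
  obtain ⟨x, -, hheight, hAx, -⟩ := T.exists_height_eq_gdist
  rw [hheight, sqrt_mul_gdist hκ]
  linarith [Real.arccos_le_pi_div_two.2 hAx, Real.pi_pos]

theorem one_add_modelCos_height_mem_uIcc (T : Triangle κ) :
    (1 + modelCos κ T.height) / 2 ∈ Set.uIcc 1 (cosHalfSq T.C T.A) := by
  obtain ⟨x, -, hheight, hAx, hwedge⟩ := T.exists_height_eq_gdist
  have hC : T.C ∈ geodesicLine T.B T.C := Submodule.subset_span (by simp)
  have hle := T.heightSq_le_wedgeSq hC
  have hxsq := form_sq T.A x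
  have hCsq := form_sq T.A T.C
  rw [hwedge] at hxsq
  rw [hheight, modelCos_gdist, cosHalfSq, form_comm T.C.vec]
  rcases le_or_gt κ 0 with hκ | hκ
  · have hx1 := one_le_form hκ T.A x
    have hxC : form κ T.A.vec x.vec ≤ form κ T.A.vec T.C.vec := by
      refine le_of_sq_le_sq ?_ (by linarith [one_le_form hκ T.A T.C])
      linarith [mul_le_mul_of_nonpos_left hle hκ]
    exact Set.Icc_subset_uIcc ⟨by linarith, by linarith⟩
  · have hx1 := (abs_le.1 (abs_form_le_one hκ T.A x)).2
    have hCx : form κ T.A.vec T.C.vec ≤ form κ T.A.vec x.vec := by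
      refine (abs_le_of_sq_le_sq' ?_ hAx).2
      linarith [mul_le_mul_of_nonneg_left hle hκ.le]
    exact Set.Icc_subset_uIcc' ⟨by linarith, by linarith⟩

end Triangle

end Height

section Midpoints

theorem eq_zero_of_form_eq_zero (hκ : κ ≠ 0) (m : ModelPlane κ) {e : Fin 3 → ℝ}
    (hee : form κ e e = 0) (hem : form κ e m.vec = 0) : e = 0 := by
  have hm := m.form_self
  simp only [form] at hee hem hm
  have he0 : e 0 ^ 2 = -(κ * (e 1 * m.vec 2 - e 2 * m.vec 1)) ^ 2 := by
    linear_combination κ * (m.vec 1 ^ 2 + m.vec 2 ^ 2) * hee - e 0 ^ 2 * hm +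
      (e 0 * m.vec 0 - κ * (e 1 * m.vec 1 + e 2 * m.vec 2)) * hem
  have h0 : e 0 = 0 := by
    have : e 0 ^ 2 ≤ 0 := he0.trans_le (neg_nonpos.2 (sq_nonneg _))
    exact pow_eq_zero_iff two_ne_zero |>.1 (le_antisymm this (sq_nonneg _))
  rw [h0, mul_zero, zero_add] at hee
  obtain ⟨h1, h2⟩ := mul_self_add_mul_self_eq_zero.1 ((mul_eq_zero.1 hee).resolve_left hκ)
  funext i
  fin_cases i <;> assumption

/-- The cosine of half the distance, in the trigonometry of curvature `κ`. -/
def cosHalf (p q : ModelPlane κ) : ℝ := √(cosHalfSq p q)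

theorem cosHalf_sq (p q : ModelPlane κ) : cosHalf p q ^ 2 = cosHalfSq p q :=
  Real.sq_sqrt (cosHalfSq_nonneg p q)

theorem modelCos_half_gdist (p q : ModelPlane κ) : modelCos κ (gdist p q / 2) = cosHalf p q := by
  rw [cosHalf, ← modelCos_half_gdist_sq, Real.sqrt_sq]
  rcases lt_trichotomy κ 0 with hκ | rfl | hκ
  · exact modelCos_of_neg hκ _ ▸ (Real.cosh_pos _).le
  · exact modelCos_zero_left _ ▸ zero_le_one
  · rw [modelCos_of_pos hκ, ← mul_div_assoc, sqrt_mul_gdist hκ]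
    have h0 := Real.arccos_nonneg (form κ p.vec q.vec)
    have hπ := Real.arccos_le_pi (form κ p.vec q.vec)
    exact Real.cos_nonneg_of_mem_Icc ⟨by linarith, by linarith⟩

namespace IsMidpoint

theorem symm {m p q : ModelPlane κ} (h : IsMidpoint m p q) : IsMidpoint m q p := by
  rw [IsMidpoint, gdist_comm q m, gdist_comm m p, gdist_comm q p]
  exact And.symm h

theorem refl (p : ModelPlane κ) : IsMidpoint p p p := by
  rw [IsMidpoint, gdist_self, zero_div, and_self]

theorem form_left {m p q : ModelPlane κ} (h : IsMidpoint m p q) :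
    form κ m.vec p.vec = cosHalf p q := by
  rw [form_comm, ← modelCos_gdist, h.1, modelCos_half_gdist]

theorem form_right {m p q : ModelPlane κ} (h : IsMidpoint m p q) :
    form κ m.vec q.vec = cosHalf p q := by
  rw [← modelCos_gdist, h.2, modelCos_half_gdist]

theorem smul_vec_of_ne_zero (hκ : κ ≠ 0) {m p q : ModelPlane κ} (h : IsMidpoint m p q) :
    (2 * cosHalf p q) • m.vec = p.vec + q.vec := by
  have hp := h.form_left
  have hq := h.form_right
  have hsq := cosHalf_sq p q
  rw [cosHalfSq] at hsq
  refine sub_eq_zero.1 (eq_zero_of_form_eq_zero hκ m ?_ ?_) <;>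
    simp only [sub_eq_add_neg, ← neg_one_smul ℝ (p.vec + q.vec), form_add_left, form_add_right,
      form_smul_left, form_smul_right, ModelPlane.form_self, form_comm _ m.vec,
      form_comm q.vec p.vec, hp, hq]
  · linear_combination -4 * hsq
  · ring

theorem smul_vec_zero_curvature {m p q : ModelPlane 0} (h : IsMidpoint m p q) :
    (2 : ℝ) • m.vec = p.vec + q.vec := by
  have hp : wedgeSq 0 p.vec m.vec = wedgeSq 0 p.vec q.vec / 4 := by
    rw [← modelSin_gdist_sq, ← modelSin_gdist_sq, h.1, modelSin_zero_left, modelSin_zero_left]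
    ring
  have hq : wedgeSq 0 m.vec q.vec = wedgeSq 0 p.vec q.vec / 4 := by
    rw [← modelSin_gdist_sq, ← modelSin_gdist_sq, h.2, modelSin_zero_left, modelSin_zero_left]
    ring
  simp only [wedgeSq_zero] at hp hq
  -- parallelogram law
  have hsum : (2 * m.vec 1 - p.vec 1 - q.vec 1) * (2 * m.vec 1 - p.vec 1 - q.vec 1) +
      (2 * m.vec 2 - p.vec 2 - q.vec 2) * (2 * m.vec 2 - p.vec 2 - q.vec 2) = 0 := by
    linear_combination 2 * hp + 2 * hq
  obtain ⟨h1, h2⟩ := mul_self_add_mul_self_eq_zero.1 hsum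
  funext i
  simp only [Pi.smul_apply, Pi.add_apply, smul_eq_mul]
  fin_cases i
  · simp only [Fin.zero_eta, ModelPlane.vec_zero_eq_one]
    norm_num
  · simp only [Fin.mk_one]; linarith
  · simp only [Fin.reduceFinMk]; linarith

theorem smul_vec {m p q : ModelPlane κ} (h : IsMidpoint m p q) :
    (2 * cosHalf p q) • m.vec = p.vec + q.vec := by
  rcases eq_or_ne κ 0 with rfl | hκ
  · rw [← h.smul_vec_zero_curvature, cosHalf, cosHalfSq, form_zero]
    norm_num
  · exact h.smul_vec_of_ne_zero hκ

theorem form_eq {m₁ m₂ p q₁ q₂ : ModelPlane κ} (h₁ : IsMidpoint m₁ p q₁) (h₂ : IsMidpoint m₂ p q₂) :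
    4 * cosHalf p q₁ * cosHalf p q₂ * form κ m₁.vec m₂.vec =
      1 + form κ p.vec q₁.vec + form κ p.vec q₂.vec + form κ q₁.vec q₂.vec := by
  have h : form κ ((2 * cosHalf p q₁) • m₁.vec) ((2 * cosHalf p q₂) • m₂.vec) =
      form κ (p.vec + q₁.vec) (p.vec + q₂.vec) := by rw [h₁.smul_vec, h₂.smul_vec]
  simp only [form_smul_left, form_smul_right, form_add_left, form_add_right, p.form_self,
    form_comm q₁.vec p.vec] at h
  linarith

end IsMidpoint

end Midpoints

section Subdivision

/-- The squared altitude from `p` of the triangle `pqr`, divided by four times the one of the inner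
piece of its medial subdivision. -/
def parallelRatio (p q r : ModelPlane κ) : ℝ :=
  cosHalfSq q r * wedgeSq κ (p.vec + q.vec) (p.vec + r.vec) / (4 * wedgeSq κ q.vec r.vec)

theorem mul_wedgeSq_add (p q r : ModelPlane κ) :
    κ * wedgeSq κ (p.vec + q.vec) (p.vec + r.vec) =
      4 * (1 + form κ p.vec q.vec) * (1 + form κ p.vec r.vec) -
        (1 + form κ p.vec q.vec + form κ p.vec r.vec + form κ q.vec r.vec) ^ 2 := by
  rw [mul_wedgeSq]
  simp only [form_add_left, form_add_right, ModelPlane.form_self, form_comm q.vec p.vec,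
    form_comm r.vec p.vec]
  ring

theorem gram_nonneg (p q r : ModelPlane κ) :
    0 ≤ 1 + 2 * form κ q.vec r.vec * form κ p.vec r.vec * form κ p.vec q.vec -
      form κ q.vec r.vec ^ 2 - form κ p.vec r.vec ^ 2 - form κ p.vec q.vec ^ 2 := by
  have h := gram_eq_sq_mul_tripleDet_sq (κ := κ) p.vec q.vec r.vec
  simp only [ModelPlane.form_self, form_comm r.vec p.vec, one_mul] at h
  rw [h]
  positivity

theorem mul_four_wedgeSq_sub_nonneg (p q r : ModelPlane κ) :
    0 ≤ κ * (4 * wedgeSq κ q.vec r.vec -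
      cosHalfSq q r * wedgeSq κ (p.vec + q.vec) (p.vec + r.vec)) := by
  have hQ := form_sq q r
  have hW := mul_wedgeSq_add p q r
  have hsign : 0 ≤ (1 - form κ q.vec r.vec) *
      ((1 - form κ p.vec q.vec) + (1 - form κ p.vec r.vec)) := by
    rcases le_or_gt κ 0 with hκ | hκ
    · exact mul_nonneg_of_nonpos_of_nonpos (by linarith [one_le_form hκ q r])
        (by linarith [one_le_form hκ p q, one_le_form hκ p r])
    · have h (a b : ModelPlane κ) : 0 ≤ 1 - form κ a.vec b.vec := by
        linarith [(abs_le.1 (abs_form_le_one hκ a b)).2]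
      exact mul_nonneg (h q r) (add_nonneg (h p q) (h p r))
  have hrhs : 0 ≤ cosHalfSq q r * ((1 - form κ q.vec r.vec) ^ 2 +
      2 * ((1 - form κ q.vec r.vec) * ((1 - form κ p.vec q.vec) + (1 - form κ p.vec r.vec))) +
      (form κ p.vec q.vec - form κ p.vec r.vec) ^ 2) :=
    mul_nonneg (cosHalfSq_nonneg q r) (by positivity)
  refine hrhs.trans_eq ?_
  rw [cosHalfSq]
  linear_combination -4 * hQ + (1 + form κ q.vec r.vec) / 2 * hW

theorem mul_wedgeSq_add_sub_nonneg (p q r : ModelPlane κ) :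
    0 ≤ κ * (cosHalfSq q r * wedgeSq κ (p.vec + q.vec) (p.vec + r.vec) -
      4 * wedgeSq κ q.vec r.vec * (cosHalfSq p q * cosHalfSq p r)) := by
  have hQ := form_sq q r
  have hW := mul_wedgeSq_add p q r
  refine (mul_nonneg (cosHalfSq_nonneg q r) (gram_nonneg p q r)).trans_eq ?_
  simp only [cosHalfSq]
  linear_combination -(1 + form κ q.vec r.vec) / 2 * hW +
    (1 + form κ p.vec q.vec) * (1 + form κ p.vec r.vec) * hQ

theorem parallelRatio_mem_uIcc {p q r : ModelPlane κ} (hqr : 0 < wedgeSq κ q.vec r.vec) :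
    parallelRatio p q r ∈ Set.uIcc 1 (cosHalfSq p q * cosHalfSq p r) := by
  have hQ : 0 < 4 * wedgeSq κ q.vec r.vec := by positivity
  have h₁ := mul_four_wedgeSq_sub_nonneg p q r
  have h₂ := mul_wedgeSq_add_sub_nonneg p q r
  rw [parallelRatio]
  rcases lt_trichotomy κ 0 with hκ | rfl | hκ
  · refine Set.Icc_subset_uIcc ⟨(one_le_div hQ).2 ?_, (div_le_iff₀' hQ).2 ?_⟩
    · linarith [nonpos_of_mul_nonneg_right h₁ hκ]
    · linarith [nonpos_of_mul_nonneg_right h₂ hκ]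
  · have hW : wedgeSq 0 (p.vec + q.vec) (p.vec + r.vec) = 4 * wedgeSq 0 q.vec r.vec := by
      simp only [wedgeSq, wedgeForm, Pi.add_apply, ModelPlane.vec_zero_eq_one]; ring
    rw [hW, mul_div_cancel_right₀ _ hQ.ne']
    simp [cosHalfSq, form_zero]
  · refine Set.Icc_subset_uIcc' ⟨(le_div_iff₀' hQ).2 ?_, (div_le_one hQ).2 ?_⟩
    · linarith [nonneg_of_mul_nonneg_right h₂ hκ]
    · linarith [nonneg_of_mul_nonneg_right h₁ hκ]

namespace Triangle

/-- The set of the three vertices. -/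
def vertices (T : Triangle κ) : Set (ModelPlane κ) := {T.A, T.B, T.C}

/-- The maximum over the three sides of a quantity depending on the endpoints. -/
def sideMax (r : ModelPlane κ → ModelPlane κ → ℝ) (T : Triangle κ) : ℝ :=
  max (r T.B T.C) (max (r T.C T.A) (r T.A T.B))

theorem A_mem_vertices (T : Triangle κ) : T.A ∈ T.vertices := by simp [vertices]

theorem B_mem_vertices (T : Triangle κ) : T.B ∈ T.vertices := by simp [vertices]

theorem C_mem_vertices (T : Triangle κ) : T.C ∈ T.vertices := by simp [vertices]

theorem forall_mem_vertices {T : Triangle κ} {P : ModelPlane κ → Prop} :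
    (∀ v ∈ T.vertices, P v) ↔ P T.A ∧ P T.B ∧ P T.C := by
  simp [vertices]

theorem forall_mem_vertices_of_sides {T : Triangle κ} {P : ModelPlane κ → ModelPlane κ → Prop}
    (hsymm : ∀ p q, P p q → P q p) (hrefl : ∀ p, P p p) (hBC : P T.B T.C) (hCA : P T.C T.A)
    (hAB : P T.A T.B) : ∀ p ∈ T.vertices, ∀ q ∈ T.vertices, P p q := by
  simp only [forall_mem_vertices]
  exact ⟨⟨hrefl _, hAB, hsymm _ _ hCA⟩, ⟨hsymm _ _ hAB, hrefl _, hBC⟩,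
    ⟨hCA, hsymm _ _ hBC, hrefl _⟩⟩

theorem le_sideMax {r : ModelPlane κ → ModelPlane κ → ℝ} {T : Triangle κ}
    (hsymm : ∀ p q, r p q = r q p) (hdiag : ∀ p, r p p ≤ T.sideMax r) :
    ∀ p ∈ T.vertices, ∀ q ∈ T.vertices, r p q ≤ T.sideMax r :=
  forall_mem_vertices_of_sides (fun p q h => hsymm p q ▸ h) hdiag (le_max_left _ _)
    ((le_max_left _ _).trans (le_max_right _ _)) ((le_max_right _ _).trans (le_max_right _ _))

theorem cosHalfSq_pos (T : Triangle κ) :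
    ∀ p ∈ T.vertices, ∀ q ∈ T.vertices, 0 < cosHalfSq p q :=
  forall_mem_vertices_of_sides (fun p q h => cosHalfSq_comm p q ▸ h)
    (fun p => cosHalfSq_self p ▸ one_pos) (MedialSubdivision.cosHalfSq_pos T.wedgeSq_BC_pos)
    (MedialSubdivision.cosHalfSq_pos T.wedgeSq_CA_pos)
    (MedialSubdivision.cosHalfSq_pos T.wedgeSq_AB_pos)

end Triangle

namespace IsMedialPiece

open Triangle

theorem exists_isMidpoint {k : Piece} {S T : Triangle κ} (h : IsMedialPiece k S T) :
    ∀ v ∈ T.vertices, ∃ p ∈ S.vertices, ∃ q ∈ S.vertices, IsMidpoint v p q := by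
  obtain ⟨D, E, F, hD, hE, hF, hk⟩ := h
  have hD' : ∃ p ∈ S.vertices, ∃ q ∈ S.vertices, IsMidpoint D p q :=
    ⟨_, S.B_mem_vertices, _, S.C_mem_vertices, hD⟩
  have hE' : ∃ p ∈ S.vertices, ∃ q ∈ S.vertices, IsMidpoint E p q :=
    ⟨_, S.C_mem_vertices, _, S.A_mem_vertices, hE⟩
  have hF' : ∃ p ∈ S.vertices, ∃ q ∈ S.vertices, IsMidpoint F p q :=
    ⟨_, S.A_mem_vertices, _, S.B_mem_vertices, hF⟩
  have hS : ∀ v ∈ S.vertices, ∃ p ∈ S.vertices, ∃ q ∈ S.vertices, IsMidpoint v p q :=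
    fun v hv => ⟨v, hv, v, hv, .refl v⟩
  rw [forall_mem_vertices]
  rcases k <;> obtain ⟨hA, hB, hC⟩ := hk <;> rw [hA, hB, hC]
  · exact ⟨hD', hE', hF'⟩
  · exact ⟨hS _ S.A_mem_vertices, hF', hE'⟩
  · exact ⟨hF', hS _ S.B_mem_vertices, hD'⟩
  · exact ⟨hE', hD', hS _ S.C_mem_vertices⟩

/-- Each side of a piece joins midpoints of segments issuing from a common vertex of the triangle;
for the half-sides one of these segments is degenerate. -/
theorem sideMax_le {k : Piece} {S T : Triangle κ} (h : IsMedialPiece k S T)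
    {r : ModelPlane κ → ModelPlane κ → ℝ} {d : ℝ}
    (hr : ∀ p ∈ S.vertices, ∀ q₁ ∈ S.vertices, ∀ q₂ ∈ S.vertices, ∀ m₁ m₂,
      IsMidpoint m₁ p q₁ → IsMidpoint m₂ p q₂ → r m₁ m₂ ≤ d) :
    T.sideMax r ≤ d := by
  obtain ⟨D, E, F, hD, hE, hF, hk⟩ := h
  have hSA := S.A_mem_vertices
  have hSB := S.B_mem_vertices
  have hSC := S.C_mem_vertices
  rw [sideMax, max_le_iff, max_le_iff]
  rcases k <;> obtain ⟨hA, hB, hC⟩ := hk <;> rw [hA, hB, hC]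
  · exact ⟨hr _ hSA _ hSC _ hSB _ _ hE.symm hF, hr _ hSB _ hSA _ hSC _ _ hF.symm hD,
      hr _ hSC _ hSB _ hSA _ _ hD.symm hE⟩
  · exact ⟨hr _ hSA _ hSB _ hSC _ _ hF hE.symm, hr _ hSA _ hSC _ hSA _ _ hE.symm (.refl _),
      hr _ hSA _ hSA _ hSB _ _ (.refl _) hF⟩
  · exact ⟨hr _ hSB _ hSB _ hSC _ _ (.refl _) hD, hr _ hSB _ hSC _ hSA _ _ hD hF.symm,
      hr _ hSB _ hSA _ hSB _ _ hF.symm (.refl _)⟩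
  · exact ⟨hr _ hSC _ hSB _ hSC _ _ hD.symm (.refl _), hr _ hSC _ hSC _ hSA _ _ (.refl _) hE,
      hr _ hSC _ hSA _ hSB _ _ hE hD.symm⟩

end IsMedialPiece

end Subdivision

section HeightRatio

theorem abs_log_le_of_mem_uIcc {a b : ℝ} (hb : 0 < b) (ha : a ∈ Set.uIcc 1 b) :
    |Real.log a| ≤ |Real.log b| := by
  rcases Set.mem_uIcc.1 ha with ⟨h1, h2⟩ | ⟨h1, h2⟩
  · rw [abs_of_nonneg (Real.log_nonneg h1), abs_of_nonneg (Real.log_nonneg (h1.trans h2))]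
    exact Real.log_le_log (by linarith) h2
  · rw [abs_of_nonpos (Real.log_nonpos (by linarith) h2),
      abs_of_nonpos (Real.log_nonpos hb.le (h1.trans h2))]
    exact neg_le_neg (Real.log_le_log hb h1)

/-- The distortion of the segment from `p` to `q`: how far its geometry is from the Euclidean one,
on a logarithmic scale. -/
def segmentDistortion (p q : ModelPlane κ) : ℝ := |Real.log (cosHalfSq p q)|

/-- The largest distortion of a side. -/
def Triangle.distortion (T : Triangle κ) : ℝ := T.sideMax segmentDistortion

theorem segmentDistortion_self (p : ModelPlane κ) : segmentDistortion p p = 0 := by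
  rw [segmentDistortion, cosHalfSq_self, Real.log_one, abs_zero]

theorem Triangle.distortion_nonneg (T : Triangle κ) : 0 ≤ T.distortion :=
  (abs_nonneg _).trans (le_max_left _ _)

theorem Triangle.segmentDistortion_le (T : Triangle κ) :
    ∀ p ∈ T.vertices, ∀ q ∈ T.vertices, segmentDistortion p q ≤ T.distortion :=
  le_sideMax (fun p q => by rw [segmentDistortion, cosHalfSq_comm, segmentDistortion])
    fun p => (segmentDistortion_self p).trans_le T.distortion_nonneg

theorem Triangle.abs_log_parallelRatio_le (T : Triangle κ) :
    |Real.log (parallelRatio T.A T.B T.C)| ≤ 2 * T.distortion := by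
  have hAB := T.cosHalfSq_pos _ T.A_mem_vertices _ T.B_mem_vertices
  have hAC := T.cosHalfSq_pos _ T.A_mem_vertices _ T.C_mem_vertices
  calc |Real.log (parallelRatio T.A T.B T.C)|
      ≤ |Real.log (cosHalfSq T.A T.B * cosHalfSq T.A T.C)| :=
        abs_log_le_of_mem_uIcc (mul_pos hAB hAC) (parallelRatio_mem_uIcc T.wedgeSq_BC_pos)
    _ ≤ segmentDistortion T.A T.B + segmentDistortion T.A T.C := by
        rw [Real.log_mul hAB.ne' hAC.ne']; exact abs_add_le _ _
    _ ≤ 2 * T.distortion := by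
        linarith [T.segmentDistortion_le _ T.A_mem_vertices _ T.B_mem_vertices,
          T.segmentDistortion_le _ T.A_mem_vertices _ T.C_mem_vertices]

theorem Triangle.parallelRatio_pos (T : Triangle κ) : 0 < parallelRatio T.A T.B T.C :=
  (lt_min one_pos (mul_pos (T.cosHalfSq_pos _ T.A_mem_vertices _ T.B_mem_vertices)
    (T.cosHalfSq_pos _ T.A_mem_vertices _ T.C_mem_vertices))).trans_le
    (parallelRatio_mem_uIcc T.wedgeSq_BC_pos).1

/-- The quotient of the squared altitudes from `A` of a piece of the medial subdivision and of the
triangle, multiplied by `4`. -/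
def Piece.heightSqRatio (k : Piece) (S : Triangle κ) : ℝ :=
  match k with
  | .inner => (parallelRatio S.A S.B S.C)⁻¹
  | .outerA => cosHalfSq S.B S.C / parallelRatio S.A S.B S.C
  | .outerB => (cosHalfSq S.A S.B)⁻¹
  | .outerC => (cosHalfSq S.C S.A)⁻¹

theorem altitudeSq_add_add_add (p q r : Fin 3 → ℝ) :
    altitudeSq κ (q + r) (r + p) (p + q) =
      4 * tripleDet p q r ^ 2 / wedgeSq κ (p + q) (p + r) := by
  rw [altitudeSq, wedgeSq_comm, add_comm r p]
  simp only [tripleDet_eq, Pi.add_apply]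
  congr 1
  ring

theorem altitudeSq_self_add_add (p q r : Fin 3 → ℝ) :
    altitudeSq κ p (p + q) (r + p) = tripleDet p q r ^ 2 / wedgeSq κ (p + q) (p + r) := by
  rw [altitudeSq, add_comm r p]
  simp only [tripleDet_eq, Pi.add_apply]
  congr 1
  ring

theorem altitudeSq_add_self_add (p q r : Fin 3 → ℝ) :
    altitudeSq κ (p + q) q (q + r) = altitudeSq κ p q r := by
  simp only [altitudeSq, tripleDet_eq, wedgeSq, wedgeForm, Pi.add_apply]
  congr 1 <;> ring

theorem altitudeSq_add_add_self (p q r : Fin 3 → ℝ) :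
    altitudeSq κ (r + p) (q + r) r = altitudeSq κ p q r := by
  simp only [altitudeSq, tripleDet_eq, wedgeSq, wedgeForm, Pi.add_apply]
  congr 1 <;> ring

theorem Triangle.two_mul_cosHalf_ne_zero (T : Triangle κ) :
    ∀ p ∈ T.vertices, ∀ q ∈ T.vertices, 2 * cosHalf p q ≠ 0 := fun p hp q hq =>
  mul_ne_zero two_ne_zero (Real.sqrt_pos.2 (T.cosHalfSq_pos p hp q hq)).ne'

theorem Piece.heightSqRatio_mul {k : Piece} {S T : Triangle κ} (h : IsMedialPiece k S T) :
    4 * T.heightSq = k.heightSqRatio S * S.heightSq := by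
  obtain ⟨D, E, F, hD, hE, hF, hk⟩ := h
  have ha := S.two_mul_cosHalf_ne_zero _ S.B_mem_vertices _ S.C_mem_vertices
  have hb := S.two_mul_cosHalf_ne_zero _ S.C_mem_vertices _ S.A_mem_vertices
  have hc := S.two_mul_cosHalf_ne_zero _ S.A_mem_vertices _ S.B_mem_vertices
  have hBC := (S.cosHalfSq_pos _ S.B_mem_vertices _ S.C_mem_vertices).ne'
  have hCA := (S.cosHalfSq_pos _ S.C_mem_vertices _ S.A_mem_vertices).ne'
  have hAB := (S.cosHalfSq_pos _ S.A_mem_vertices _ S.B_mem_vertices).ne'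
  have hQ := S.wedgeSq_BC_pos.ne'
  rcases k <;> obtain ⟨hA, hB, hC⟩ := hk <;>
    simp only [Triangle.heightSq, Piece.heightSqRatio, hA, hB, hC]
  · have hDEF := altitudeSq_smul (κ := κ) hb hc (2 * cosHalf S.B S.C) D.vec E.vec F.vec
    rw [hD.smul_vec, hE.smul_vec, hF.smul_vec, altitudeSq_add_add_add, mul_pow, cosHalf_sq] at hDEF
    have hABC : altitudeSq κ S.A.vec S.B.vec S.C.vec =
        tripleDet S.A.vec S.B.vec S.C.vec ^ 2 / wedgeSq κ S.B.vec S.C.vec := rfl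
    rw [parallelRatio, hABC]
    field_simp
    linear_combination -hDEF / 4
  · have hAFE := altitudeSq_smul (κ := κ) hc hb 1 S.A.vec F.vec E.vec
    rw [hF.smul_vec, hE.smul_vec, one_smul, altitudeSq_self_add_add, one_pow, one_mul] at hAFE
    rw [← hAFE, parallelRatio, altitudeSq]
    field_simp
  · have hFBD := altitudeSq_smul (κ := κ) one_ne_zero ha (2 * cosHalf S.A S.B) F.vec S.B.vec D.vec
    rw [hF.smul_vec, hD.smul_vec, one_smul, altitudeSq_add_self_add, mul_pow, cosHalf_sq] at hFBD
    rw [hFBD, mul_assoc, mul_left_comm, inv_mul_cancel_left₀ hAB]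
    norm_num
  · have hEDC := altitudeSq_smul (κ := κ) ha one_ne_zero (2 * cosHalf S.C S.A) E.vec D.vec S.C.vec
    rw [hE.smul_vec, hD.smul_vec, one_smul, altitudeSq_add_add_self, mul_pow, cosHalf_sq] at hEDC
    rw [hEDC, mul_assoc, mul_left_comm, inv_mul_cancel_left₀ hCA]
    norm_num

theorem Piece.heightSqRatio_pos (k : Piece) (S : Triangle κ) : 0 < k.heightSqRatio S := by
  rcases k
  · exact inv_pos.2 S.parallelRatio_pos
  · exact div_pos (S.cosHalfSq_pos _ S.B_mem_vertices _ S.C_mem_vertices) S.parallelRatio_pos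
  · exact inv_pos.2 (S.cosHalfSq_pos _ S.A_mem_vertices _ S.B_mem_vertices)
  · exact inv_pos.2 (S.cosHalfSq_pos _ S.C_mem_vertices _ S.A_mem_vertices)

theorem Piece.abs_log_heightSqRatio_le (k : Piece) (S : Triangle κ) :
    |Real.log (k.heightSqRatio S)| ≤ 3 * S.distortion := by
  have hd := S.distortion_nonneg
  have hρ := S.abs_log_parallelRatio_le
  have hBC : |Real.log (cosHalfSq S.B S.C)| ≤ S.distortion :=
    S.segmentDistortion_le _ S.B_mem_vertices _ S.C_mem_vertices
  have hCA : |Real.log (cosHalfSq S.C S.A)| ≤ S.distortion :=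
    S.segmentDistortion_le _ S.C_mem_vertices _ S.A_mem_vertices
  have hAB : |Real.log (cosHalfSq S.A S.B)| ≤ S.distortion :=
    S.segmentDistortion_le _ S.A_mem_vertices _ S.B_mem_vertices
  rcases k <;> simp only [heightSqRatio, Real.log_inv, abs_neg]
  · linarith
  · rw [Real.log_div (S.cosHalfSq_pos _ S.B_mem_vertices _ S.C_mem_vertices).ne'
      S.parallelRatio_pos.ne']
    linarith [abs_sub (Real.log (cosHalfSq S.B S.C)) (Real.log (parallelRatio S.A S.B S.C))]
  · linarith
  · linarith

theorem IsMedialPiece.abs_log_heightSq_sub_le {k : Piece} {S T : Triangle κ}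
    (h : IsMedialPiece k S T) :
    |Real.log (4 * T.heightSq) - Real.log S.heightSq| ≤ 3 * S.distortion := by
  rw [Piece.heightSqRatio_mul h, Real.log_mul (k.heightSqRatio_pos S).ne' S.heightSq_pos.ne',
    add_sub_cancel_right]
  exact k.abs_log_heightSqRatio_le S

namespace Triangle

theorem modelSin_height_div_mem_uIcc (T : Triangle κ) :
    modelSin κ T.height / T.height ∈ Set.uIcc 1 ((1 + modelCos κ T.height) / 2) :=
  modelSin_div_self_mem_uIcc T.height_pos fun hκ => T.sqrt_mul_height_lt_pi hκ

theorem abs_log_heightSq_sub_le (T : Triangle κ) :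
    |Real.log T.heightSq - 2 * Real.log T.height| ≤ 2 * T.distortion := by
  have hCA := T.cosHalfSq_pos _ T.C_mem_vertices _ T.A_mem_vertices
  have hcos := T.one_add_modelCos_height_mem_uIcc
  have hcos_pos : 0 < (1 + modelCos κ T.height) / 2 :=
    (lt_min one_pos hCA).trans_le hcos.1
  have hsin_ne : modelSin κ T.height ≠ 0 :=
    (div_ne_zero_iff.1 ((lt_min one_pos hcos_pos).trans_le T.modelSin_height_div_mem_uIcc.1).ne').1
  have hle : |Real.log (modelSin κ T.height / T.height)| ≤ T.distortion :=
    (abs_log_le_of_mem_uIcc hcos_pos T.modelSin_height_div_mem_uIcc).trans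
      ((abs_log_le_of_mem_uIcc hCA hcos).trans
        (T.segmentDistortion_le _ T.C_mem_vertices _ T.A_mem_vertices))
  rw [Real.log_div hsin_ne T.height_pos.ne'] at hle
  rw [← T.modelSin_height_sq, Real.log_pow, Nat.cast_two, ← mul_sub, abs_mul, abs_two]
  linarith

end Triangle

theorem IsNested.abs_log_heightSq_sub_le {t : ℕ → Triangle κ} (h : IsNested t) (n : ℕ) :
    |Real.log (4 ^ n * (t n).heightSq) - Real.log (t 0).heightSq| ≤
      ∑ i ∈ Finset.range n, 3 * (t i).distortion := by
  have hlog (i : ℕ) : Real.log (4 ^ i * (t i).heightSq) =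
      i * Real.log 4 + Real.log (t i).heightSq := by
    rw [Real.log_mul (by positivity) (t i).heightSq_pos.ne', Real.log_pow]
  have hdist := dist_le_range_sum_of_dist_le (f := fun i => Real.log (4 ^ i * (t i).heightSq)) n
    (d := fun i => 3 * (t i).distortion) fun {i} _ => by
      obtain ⟨k, hk⟩ := h i
      have hstep := hk.abs_log_heightSq_sub_le
      rw [Real.log_mul four_ne_zero (t (i + 1)).heightSq_pos.ne'] at hstep
      rw [dist_comm, Real.dist_eq, hlog, hlog, Nat.cast_succ]
      ring_nf at hstep ⊢
      exact hstep
  rwa [dist_comm, Real.dist_eq, pow_zero, one_mul] at hdist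

theorem IsNested.abs_log_height_sub_le {t : ℕ → Triangle κ} (h : IsNested t) (n : ℕ) :
    |Real.log (2 ^ n * (t n).height) - Real.log (t 0).height| ≤
      3 * ∑ i ∈ Finset.range (n + 1), (t i).distortion := by
  have hsq := h.abs_log_heightSq_sub_le n
  have hn := (t n).abs_log_heightSq_sub_le
  have h0 := (t 0).abs_log_heightSq_sub_le
  have hsum := Finset.single_le_sum (fun i _ => (t i).distortion_nonneg)
    (Finset.mem_range.2 n.succ_pos)
  rw [Finset.sum_range_succ] at hsum ⊢
  rw [← Finset.mul_sum, Real.log_mul (by positivity) (t n).heightSq_pos.ne', Real.log_pow,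
    show (4 : ℝ) = 2 ^ 2 by norm_num, Real.log_pow, Nat.cast_two] at hsq
  rw [Real.log_mul (by positivity) (t n).height_pos.ne', Real.log_pow]
  have hS : 0 ≤ ∑ i ∈ Finset.range n, (t i).distortion :=
    Finset.sum_nonneg fun i _ => (t i).distortion_nonneg
  rw [abs_le] at hsq hn h0 ⊢
  constructor <;> linarith [(t n).distortion_nonneg]

end HeightRatio

section TotalDistortion

theorem sum_range_le_div_one_sub {a : ℕ → ℝ} {r : ℝ} (ha : 0 ≤ a 0) (hr : 0 ≤ r) (hr1 : r < 1)
    (h : ∀ n, a (n + 1) ≤ r * a n) (N : ℕ) : ∑ i ∈ Finset.range N, a i ≤ a 0 / (1 - r) :=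
  calc ∑ i ∈ Finset.range N, a i ≤ ∑ i ∈ Finset.range N, r ^ i * a 0 :=
        Finset.sum_le_sum fun i _ => le_geom hr i fun k _ => h k
    _ = (∑ i ∈ Finset.range N, r ^ i) * a 0 := (Finset.sum_mul ..).symm
    _ ≤ (1 - r)⁻¹ * a 0 := by
        rw [← tsum_geometric_of_lt_one hr hr1]
        gcongr
        exact (summable_geometric_of_lt_one hr hr1).sum_le_tsum _ fun i _ => pow_nonneg hr i
    _ = a 0 / (1 - r) := inv_mul_eq_div _ _

/-- The supremum of the sums of the distortions along the nested sequences that start at `T`. -/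
def Triangle.totalDistortion (T : Triangle κ) : ℝ :=
  sSup {s | ∃ t N, IsNested t ∧ t 0 = T ∧ s = ∑ i ∈ Finset.range N, (t i).distortion}

theorem Triangle.totalDistortion_nonneg (T : Triangle κ) : 0 ≤ T.totalDistortion :=
  Real.sSup_nonneg <| by
    rintro _ ⟨t, N, -, -, rfl⟩
    exact Finset.sum_nonneg fun i _ => (t i).distortion_nonneg

theorem Triangle.totalDistortion_le {T : Triangle κ} {C : ℝ} (hC : 0 ≤ C)
    (h : ∀ t, IsNested t → t 0 = T → ∀ N, ∑ i ∈ Finset.range N, (t i).distortion ≤ C) :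
    T.totalDistortion ≤ C :=
  Real.sSup_le (by rintro _ ⟨t, N, ht, h0, rfl⟩; exact h t ht h0 N) hC

theorem IsNested.sum_distortion_le_totalDistortion {t : ℕ → Triangle κ} (ht : IsNested t) {C : ℝ}
    (h : ∀ s, IsNested s → s 0 = t 0 → ∀ N, ∑ i ∈ Finset.range N, (s i).distortion ≤ C) (N : ℕ) :
    ∑ i ∈ Finset.range N, (t i).distortion ≤ (t 0).totalDistortion :=
  le_csSup ⟨C, by rintro _ ⟨s, N, hs, h0, rfl⟩; exact h s hs h0 N⟩ ⟨t, N, ht, rfl, rfl⟩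

end TotalDistortion

section NonposCurvature

theorem form_midpoints_sq_le {m₁ m₂ p q₁ q₂ : ModelPlane κ} (h₁ : IsMidpoint m₁ p q₁)
    (h₂ : IsMidpoint m₂ p q₂) (hc₁ : 0 < cosHalfSq p q₁) (hc₂ : 0 < cosHalfSq p q₂) :
    form κ m₁.vec m₂.vec ^ 2 ≤ cosHalfSq q₁ q₂ := by
  refine le_of_mul_le_mul_left ?_ (by positivity : 0 < 16 * cosHalfSq p q₁ * cosHalfSq p q₂)
  have hsq : 16 * cosHalfSq p q₁ * cosHalfSq p q₂ * form κ m₁.vec m₂.vec ^ 2 =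
      (1 + form κ p.vec q₁.vec + form κ p.vec q₂.vec + form κ q₁.vec q₂.vec) ^ 2 := by
    rw [← h₁.form_eq h₂, ← cosHalf_sq, ← cosHalf_sq]
    ring
  rw [hsq]
  simp only [cosHalfSq]
  linear_combination gram_nonneg p q₁ q₂

theorem segmentDistortion_midpoints_le (hκ : κ ≤ 0) {m₁ m₂ p q₁ q₂ : ModelPlane κ}
    (h₁ : IsMidpoint m₁ p q₁) (h₂ : IsMidpoint m₂ p q₂) :
    segmentDistortion m₁ m₂ ≤ 1 / 2 * segmentDistortion q₁ q₂ := by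
  have hone (p q : ModelPlane κ) : 1 ≤ cosHalfSq p q := by
    rw [cosHalfSq]; linarith [one_le_form hκ p q]
  have hsq := form_midpoints_sq_le h₁ h₂ (one_pos.trans_le (hone _ _)) (one_pos.trans_le (hone _ _))
  have hform := one_le_form hκ m₁ m₂
  have hpow : cosHalfSq m₁ m₂ ^ 2 ≤ cosHalfSq q₁ q₂ :=
    (pow_le_pow_left₀ (cosHalfSq_nonneg _ _) (by rw [cosHalfSq]; linarith) 2).trans hsq
  have hlog := Real.log_le_log (pow_pos (one_pos.trans_le (hone m₁ m₂)) 2) hpow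
  rw [Real.log_pow, Nat.cast_two] at hlog
  rw [segmentDistortion, segmentDistortion, abs_of_nonneg (Real.log_nonneg (hone _ _)),
    abs_of_nonneg (Real.log_nonneg (hone _ _))]
  linarith

theorem IsNested.sum_distortion_le_of_nonpos (hκ : κ ≤ 0) {t : ℕ → Triangle κ} (ht : IsNested t)
    (N : ℕ) : ∑ i ∈ Finset.range N, (t i).distortion ≤ 2 * (t 0).distortion := by
  have hstep (n : ℕ) : (t (n + 1)).distortion ≤ 1 / 2 * (t n).distortion := by
    obtain ⟨k, hk⟩ := ht n
    exact hk.sideMax_le fun p _ q₁ hq₁ q₂ hq₂ m₁ m₂ h₁ h₂ =>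
      (segmentDistortion_midpoints_le hκ h₁ h₂).trans
        (by gcongr; exact (t n).segmentDistortion_le _ hq₁ _ hq₂)
  exact (sum_range_le_div_one_sub (a := fun n => (t n).distortion) (t 0).distortion_nonneg
    (by norm_num) (by norm_num) hstep N).trans_eq (by ring)

end NonposCurvature

section GnomonicProjection

open scoped RealInnerProductSpace

variable {E : Type*} [NormedAddCommGroup E] [InnerProductSpace ℝ E]

theorem dist_lineMap_lineMap_le {P Q R : E} {s t θ d : ℝ} (hs : s ∈ Set.Icc 0 θ)
    (ht : t ∈ Set.Icc 0 θ) (hPQ : dist P Q ≤ d) (hPR : dist P R ≤ d) (hQR : dist Q R ≤ d) :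
    dist (AffineMap.lineMap P Q s) (AffineMap.lineMap P R t) ≤ θ * d := by
  wlog hts : t ≤ s generalizing Q R s t
  · rw [dist_comm]
    exact this ht hs hPR hPQ (dist_comm Q R ▸ hQR) (le_of_not_ge hts)
  rw [dist_comm, dist_eq_norm] at hPQ
  rw [dist_eq_norm] at hQR
  have hd : 0 ≤ d := (norm_nonneg _).trans hQR
  calc dist (AffineMap.lineMap P Q s) (AffineMap.lineMap P R t)
      = ‖t • (Q - R) + (s - t) • (Q - P)‖ := by
        rw [dist_eq_norm, AffineMap.lineMap_apply_module', AffineMap.lineMap_apply_module']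
        congr 1
        module
    _ ≤ t * d + (s - t) * d := by
        refine norm_add_le_of_le ?_ ?_ <;> rw [norm_smul, Real.norm_of_nonneg]
        exacts [mul_le_mul_of_nonneg_left hQR ht.1, ht.1,
          mul_le_mul_of_nonneg_left hPQ (sub_nonneg.2 hts), sub_nonneg.2 hts]
    _ = s * d := by ring
    _ ≤ θ * d := mul_le_mul_of_nonneg_right hs.2 hd

/-- The central projection of `p` to the affine hyperplane `⟪u, ·⟫ = 1`. -/
def gnomonic (u p : E) : E := ⟪u, p⟫⁻¹ • p

theorem gnomonic_smul {c : ℝ} (hc : c ≠ 0) (u p : E) : gnomonic u (c • p) = gnomonic u p := by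
  rw [gnomonic, gnomonic, inner_smul_right, smul_smul, mul_inv_rev, inv_mul_cancel_right₀ hc]

theorem gnomonic_add {u p q : E} (hp : 0 < ⟪u, p⟫) (hq : 0 < ⟪u, q⟫) :
    gnomonic u (p + q) =
      AffineMap.lineMap (gnomonic u p) (gnomonic u q) (⟪u, q⟫ / (⟪u, p⟫ + ⟪u, q⟫)) := by
  have hpq := (add_pos hp hq).ne'
  rw [AffineMap.lineMap_apply_module, gnomonic, gnomonic, gnomonic, inner_add_right, smul_smul,
    smul_smul, smul_add]
  congr 2 <;> field_simp
  ring

theorem dist_gnomonic_sq {u p q : E} (hp : ‖p‖ = 1) (hq : ‖q‖ = 1) :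
    dist (gnomonic u p) (gnomonic u q) ^ 2 =
      (⟪u, p⟫⁻¹ - ⟪u, q⟫⁻¹) ^ 2 + 2 * (⟪u, p⟫⁻¹ * ⟪u, q⟫⁻¹) * (1 - ⟪p, q⟫) := by
  rw [dist_eq_norm, norm_sub_sq_real, gnomonic, gnomonic, norm_smul, norm_smul, hp, hq,
    real_inner_smul_left, real_inner_smul_right, mul_one, mul_one, Real.norm_eq_abs,
    Real.norm_eq_abs, sq_abs, sq_abs]
  ring

variable {u p q : E} (hu : ‖u‖ = 1) (hp : ‖p‖ = 1) (hq : ‖q‖ = 1)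

include hu hp in
theorem inner_le_one_of_norm_eq_one : ⟪u, p⟫ ≤ 1 := by
  simpa only [hu, hp, mul_one] using real_inner_le_norm u p

include hu hp hq in
theorem one_sub_inner_le_dist_gnomonic_sq (hup : 0 < ⟪u, p⟫) (huq : 0 < ⟪u, q⟫) :
    2 * (1 - ⟪p, q⟫) ≤ dist (gnomonic u p) (gnomonic u q) ^ 2 := by
  have h1 : 0 ≤ 1 - ⟪p, q⟫ := sub_nonneg.2 (inner_le_one_of_norm_eq_one hp hq)
  have h2 : 1 ≤ ⟪u, p⟫⁻¹ * ⟪u, q⟫⁻¹ :=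
    one_le_mul_of_one_le_of_one_le ((one_le_inv₀ hup).2 (inner_le_one_of_norm_eq_one hu hp))
      ((one_le_inv₀ huq).2 (inner_le_one_of_norm_eq_one hu hq))
  rw [dist_gnomonic_sq hp hq]
  nlinarith [mul_le_mul_of_nonneg_right h2 h1, sq_nonneg (⟪u, p⟫⁻¹ - ⟪u, q⟫⁻¹)]

include hu hp hq in
theorem dist_gnomonic_sq_le {m : ℝ} (hm : 0 < m) (hup : m ≤ ⟪u, p⟫) (huq : m ≤ ⟪u, q⟫) :
    dist (gnomonic u p) (gnomonic u q) ^ 2 ≤ 4 * (1 - ⟪p, q⟫) / m ^ 4 := by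
  have hup0 := hm.trans_le hup
  have huq0 := hm.trans_le huq
  have hm1 : m ≤ 1 := hup.trans (inner_le_one_of_norm_eq_one hu hp)
  have hpq : 0 ≤ 1 - ⟪p, q⟫ := sub_nonneg.2 (inner_le_one_of_norm_eq_one hp hq)
  have hinv : ⟪u, p⟫⁻¹ * ⟪u, q⟫⁻¹ ≤ (m ^ 2)⁻¹ := by
    rw [pow_two, mul_inv]; gcongr
  have hm4 : (m ^ 2)⁻¹ ≤ (m ^ 4)⁻¹ :=
    inv_anti₀ (pow_pos hm 4) (pow_le_pow_of_le_one hm.le hm1 (by norm_num))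
  have hsub : (⟪u, q⟫ - ⟪u, p⟫) ^ 2 ≤ 2 * (1 - ⟪p, q⟫) :=
    calc (⟪u, q⟫ - ⟪u, p⟫) ^ 2 = ⟪u, q - p⟫ ^ 2 := by rw [inner_sub_right]
      _ ≤ ‖q - p‖ ^ 2 := by
          simpa only [hu, one_mul, sq_abs] using
            pow_le_pow_left₀ (abs_nonneg _) (abs_real_inner_le_norm u (q - p)) 2
      _ = 2 * (1 - ⟪p, q⟫) := by
          rw [norm_sub_sq_real, hp, hq, real_inner_comm]; ring
  have hdiff : (⟪u, p⟫⁻¹ - ⟪u, q⟫⁻¹) ^ 2 ≤ (m ^ 4)⁻¹ * (2 * (1 - ⟪p, q⟫)) :=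
    calc (⟪u, p⟫⁻¹ - ⟪u, q⟫⁻¹) ^ 2 = (⟪u, p⟫⁻¹ * ⟪u, q⟫⁻¹) ^ 2 * (⟪u, q⟫ - ⟪u, p⟫) ^ 2 := by
          field_simp
      _ ≤ ((m ^ 2)⁻¹) ^ 2 * (2 * (1 - ⟪p, q⟫)) := by gcongr
      _ = (m ^ 4)⁻¹ * (2 * (1 - ⟪p, q⟫)) := by rw [inv_pow, ← pow_mul]
  rw [dist_gnomonic_sq hp hq, div_eq_inv_mul]
  linarith [mul_le_mul_of_nonneg_right (hinv.trans hm4) hpq]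

include hu hp hq in
theorem sq_le_one_add_inner_div_two {m : ℝ} (hm : 0 ≤ m) (hup : m ≤ ⟪u, p⟫) (huq : m ≤ ⟪u, q⟫) :
    m ^ 2 ≤ (1 + ⟪p, q⟫) / 2 := by
  have h : 2 * m ≤ ‖p + q‖ :=
    calc 2 * m ≤ ⟪u, p + q⟫ := by rw [inner_add_right]; linarith
      _ ≤ ‖p + q‖ := by simpa only [hu, one_mul] using real_inner_le_norm u (p + q)
  have hsq := pow_le_pow_left₀ (by positivity) h 2
  rw [norm_add_sq_real, hp, hq] at hsq
  linarith

end GnomonicProjection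

section PosCurvature

open scoped RealInnerProductSpace

/-- For `κ ≥ 0`, the point of the unit sphere of `ℝ³` corresponding to a point of `M_κ²`. -/
def ModelPlane.toSphere (p : ModelPlane κ) : EuclideanSpace ℝ (Fin 3) :=
  !₂[p.vec 0, √κ * p.vec 1, √κ * p.vec 2]

theorem inner_toSphere (hκ : 0 ≤ κ) (p q : ModelPlane κ) :
    ⟪p.toSphere, q.toSphere⟫ = form κ p.vec q.vec := by
  simp only [ModelPlane.toSphere, PiLp.inner_apply, RCLike.inner_apply, conj_trivial,
    Fin.sum_univ_three, Matrix.cons_val, form]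
  linear_combination (p.vec 1 * q.vec 1 + p.vec 2 * q.vec 2) * Real.mul_self_sqrt hκ

theorem norm_toSphere (hκ : 0 ≤ κ) (p : ModelPlane κ) : ‖p.toSphere‖ = 1 := by
  rw [norm_eq_sqrt_real_inner, inner_toSphere hκ, p.form_self, Real.sqrt_one]

theorem IsMidpoint.smul_toSphere {m p q : ModelPlane κ} (h : IsMidpoint m p q) :
    (2 * cosHalf p q) • m.toSphere = p.toSphere + q.toSphere := by
  have hi (i : Fin 3) : 2 * cosHalf p q * m.vec i = p.vec i + q.vec i := congrFun h.smul_vec i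
  ext i
  fin_cases i <;>
    simp only [ModelPlane.toSphere, PiLp.smul_apply, PiLp.add_apply, smul_eq_mul, Fin.zero_eta,
      Fin.mk_one, Fin.reduceFinMk, Matrix.cons_val]
  · exact hi 0
  · linear_combination √κ * hi 1
  · linear_combination √κ * hi 2

theorem Triangle.exists_center (hκ : 0 < κ) (T : Triangle κ) :
    ∃ u : EuclideanSpace ℝ (Fin 3), ‖u‖ = 1 ∧ ∃ m > 0, ∀ v ∈ T.vertices, m ≤ ⟪u, v.toSphere⟫ := by
  obtain ⟨w, hA, hB, hC⟩ := T.hemisphere hκ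
  set u : EuclideanSpace ℝ (Fin 3) := !₂[w 0, w 1 / √κ, w 2 / √κ] with hu
  have hinner (p : ModelPlane κ) : ⟪u, p.toSphere⟫ = w ⬝ᵥ p.vec := by
    simp only [hu, ModelPlane.toSphere, PiLp.inner_apply, RCLike.inner_apply, conj_trivial,
      Fin.sum_univ_three, Matrix.cons_val, dotProduct]
    field_simp
  have hu0 : u ≠ 0 := fun h => by
    rw [← hinner, h, inner_zero_left] at hA
    exact hA.false
  have hpos : ∀ v ∈ T.vertices, 0 < ‖u‖⁻¹ * (w ⬝ᵥ v.vec) := T.forall_mem_vertices.2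
    ⟨by positivity, by positivity, by positivity⟩
  obtain ⟨v₀, hv₀, hmin⟩ := Set.exists_min_image T.vertices (fun v => ‖u‖⁻¹ * (w ⬝ᵥ v.vec))
    (by simp [vertices]) ⟨_, T.A_mem_vertices⟩
  refine ⟨‖u‖⁻¹ • u, norm_smul_inv_norm hu0, _, hpos v₀ hv₀, fun v hv => ?_⟩
  rw [real_inner_smul_left, hinner]
  exact hmin v hv

theorem IsMedialPiece.le_inner_toSphere (hκ : 0 < κ) {k : Piece} {S T : Triangle κ}
    (h : IsMedialPiece k S T) {u : EuclideanSpace ℝ (Fin 3)} {m : ℝ} (hm : 0 < m)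
    (hS : ∀ v ∈ S.vertices, m ≤ ⟪u, v.toSphere⟫) : ∀ v ∈ T.vertices, m ≤ ⟪u, v.toSphere⟫ := by
  intro v hv
  obtain ⟨p, hp, q, hq, hmid⟩ := h.exists_isMidpoint v hv
  have hsum : 2 * cosHalf p q * ⟪u, v.toSphere⟫ = ⟪u, p.toSphere⟫ + ⟪u, q.toSphere⟫ := by
    rw [← real_inner_smul_right, hmid.smul_toSphere, inner_add_right]
  have hle : m ≤ cosHalf p q * ⟪u, v.toSphere⟫ := by linarith [hS p hp, hS q hq]
  have hcos : cosHalf p q ≤ 1 := Real.sqrt_le_one.2 <| by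
    rw [cosHalfSq]; linarith [(abs_le.1 (abs_form_le_one hκ p q)).2]
  have hpos : 0 < ⟪u, v.toSphere⟫ := pos_of_mul_pos_right (hm.trans_le hle) (Real.sqrt_nonneg _)
  exact hle.trans (mul_le_of_le_one_left hpos.le hcos)

theorem IsNested.le_inner_toSphere (hκ : 0 < κ) {t : ℕ → Triangle κ} (ht : IsNested t)
    {u : EuclideanSpace ℝ (Fin 3)} {m : ℝ} (hm : 0 < m)
    (h0 : ∀ v ∈ (t 0).vertices, m ≤ ⟪u, v.toSphere⟫) (n : ℕ) :
    ∀ v ∈ (t n).vertices, m ≤ ⟪u, v.toSphere⟫ := by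
  induction n with
  | zero => exact h0
  | succ n ih => obtain ⟨k, hk⟩ := ht n; exact hk.le_inner_toSphere hκ hm ih

/-- The distance of the images of two points under the central projection of the sphere to its
tangent plane at `u`. -/
def gnomonicDist (u : EuclideanSpace ℝ (Fin 3)) (p q : ModelPlane κ) : ℝ :=
  dist (gnomonic u p.toSphere) (gnomonic u q.toSphere)

theorem Triangle.sideMax_gnomonicDist_nonneg (u : EuclideanSpace ℝ (Fin 3)) (T : Triangle κ) :
    0 ≤ T.sideMax (gnomonicDist u) :=
  dist_nonneg.trans (le_max_left _ _)

theorem Triangle.gnomonicDist_le_sideMax (u : EuclideanSpace ℝ (Fin 3)) (T : Triangle κ) :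
    ∀ p ∈ T.vertices, ∀ q ∈ T.vertices, gnomonicDist u p q ≤ T.sideMax (gnomonicDist u) :=
  le_sideMax (fun _ _ => dist_comm _ _)
    fun p => (dist_self (gnomonic u p.toSphere)).trans_le (T.sideMax_gnomonicDist_nonneg u)

variable {u : EuclideanSpace ℝ (Fin 3)} {m : ℝ}

theorem IsMidpoint.gnomonic_eq {x p q : ModelPlane κ} (h : IsMidpoint x p q)
    (hp : 0 < ⟪u, p.toSphere⟫) (hq : 0 < ⟪u, q.toSphere⟫) :
    gnomonic u x.toSphere = AffineMap.lineMap (gnomonic u p.toSphere) (gnomonic u q.toSphere)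
      (⟪u, q.toSphere⟫ / (⟪u, p.toSphere⟫ + ⟪u, q.toSphere⟫)) := by
  have hne : 2 * cosHalf p q ≠ 0 := fun h0 => by
    have hsum := congrArg (⟪u, ·⟫) h.smul_toSphere
    simp only [h0, zero_smul, inner_zero_right, inner_add_right] at hsum
    linarith
  rw [← gnomonic_smul hne, h.smul_toSphere, gnomonic_add hp hq]

theorem inner_div_add_mem_Icc (hκ : 0 < κ) (hu : ‖u‖ = 1) (hm : 0 < m) {p q : ModelPlane κ}
    (hp : m ≤ ⟪u, p.toSphere⟫) (hq : m ≤ ⟪u, q.toSphere⟫) :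
    ⟪u, q.toSphere⟫ / (⟪u, p.toSphere⟫ + ⟪u, q.toSphere⟫) ∈ Set.Icc 0 (1 + m)⁻¹ := by
  have hp0 := hm.trans_le hp
  have hq0 := hm.trans_le hq
  refine ⟨by positivity, ?_⟩
  rw [inv_eq_one_div, div_le_div_iff₀ (by positivity) (by positivity)]
  have hq1 := inner_le_one_of_norm_eq_one hu (norm_toSphere hκ.le q)
  linarith [mul_le_of_le_one_left hm.le hq1]

theorem IsMedialPiece.sideMax_gnomonicDist_le (hκ : 0 < κ) (hu : ‖u‖ = 1) (hm : 0 < m)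
    {k : Piece} {S T : Triangle κ} (h : IsMedialPiece k S T)
    (hS : ∀ v ∈ S.vertices, m ≤ ⟪u, v.toSphere⟫) :
    T.sideMax (gnomonicDist u) ≤ (1 + m)⁻¹ * S.sideMax (gnomonicDist u) := by
  refine h.sideMax_le fun p hp q₁ hq₁ q₂ hq₂ m₁ m₂ h₁ h₂ => ?_
  rw [gnomonicDist, h₁.gnomonic_eq (hm.trans_le (hS p hp)) (hm.trans_le (hS q₁ hq₁)),
    h₂.gnomonic_eq (hm.trans_le (hS p hp)) (hm.trans_le (hS q₂ hq₂))]
  exact dist_lineMap_lineMap_le (inner_div_add_mem_Icc hκ hu hm (hS p hp) (hS q₁ hq₁))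
    (inner_div_add_mem_Icc hκ hu hm (hS p hp) (hS q₂ hq₂))
    (S.gnomonicDist_le_sideMax u p hp q₁ hq₁) (S.gnomonicDist_le_sideMax u p hp q₂ hq₂)
    (S.gnomonicDist_le_sideMax u q₁ hq₁ q₂ hq₂)

theorem segmentDistortion_le_gnomonicDist (hκ : 0 < κ) (hu : ‖u‖ = 1) (hm : 0 < m)
    {p q : ModelPlane κ} (hp : m ≤ ⟪u, p.toSphere⟫) (hq : m ≤ ⟪u, q.toSphere⟫) :
    segmentDistortion p q ≤ gnomonicDist u p q ^ 2 / (4 * m ^ 2) := by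
  have hp1 := norm_toSphere hκ.le p
  have hq1 := norm_toSphere hκ.le q
  have hlow : m ^ 2 ≤ cosHalfSq p q := by
    rw [cosHalfSq, ← inner_toSphere hκ.le]
    exact sq_le_one_add_inner_div_two hu hp1 hq1 hm.le hp hq
  have hdist : 4 * (1 - cosHalfSq p q) ≤ gnomonicDist u p q ^ 2 := by
    have h := one_sub_inner_le_dist_gnomonic_sq hu hp1 hq1 (hm.trans_le hp) (hm.trans_le hq)
    rw [inner_toSphere hκ.le] at h
    rw [cosHalfSq, gnomonicDist]
    linarith
  have hpos : 0 < cosHalfSq p q := (pow_pos hm 2).trans_le hlow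
  have hle : cosHalfSq p q ≤ 1 := by
    rw [cosHalfSq]; linarith [(abs_le.1 (abs_form_le_one hκ p q)).2]
  calc segmentDistortion p q = Real.log (cosHalfSq p q)⁻¹ := by
        rw [segmentDistortion, abs_of_nonpos (Real.log_nonpos hpos.le hle), Real.log_inv]
    _ ≤ (cosHalfSq p q)⁻¹ - 1 := Real.log_le_sub_one_of_pos (inv_pos.2 hpos)
    _ = (1 - cosHalfSq p q) / cosHalfSq p q := by rw [sub_div, div_self hpos.ne', one_div]
    _ ≤ (1 - cosHalfSq p q) / m ^ 2 := by gcongr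
    _ ≤ gnomonicDist u p q ^ 2 / (4 * m ^ 2) := by
        rw [div_le_div_iff₀ (by positivity) (by positivity)]
        linarith [mul_le_mul_of_nonneg_right hdist (sq_nonneg m)]

theorem Triangle.distortion_le_gnomonicDist (hκ : 0 < κ) (hu : ‖u‖ = 1) (hm : 0 < m)
    {T : Triangle κ} (hT : ∀ v ∈ T.vertices, m ≤ ⟪u, v.toSphere⟫) :
    T.distortion ≤ T.sideMax (gnomonicDist u) ^ 2 / (4 * m ^ 2) := by
  have hle : ∀ p ∈ T.vertices, ∀ q ∈ T.vertices,
      segmentDistortion p q ≤ T.sideMax (gnomonicDist u) ^ 2 / (4 * m ^ 2) := fun p hp q hq =>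
    (segmentDistortion_le_gnomonicDist hκ hu hm (hT p hp) (hT q hq)).trans <| by
      gcongr
      · exact dist_nonneg
      · exact T.gnomonicDist_le_sideMax u p hp q hq
  exact max_le (hle _ T.B_mem_vertices _ T.C_mem_vertices)
    (max_le (hle _ T.C_mem_vertices _ T.A_mem_vertices) (hle _ T.A_mem_vertices _ T.B_mem_vertices))

theorem IsNested.sum_distortion_le_of_pos (hκ : 0 < κ) (hu : ‖u‖ = 1) (hm : 0 < m)
    {t : ℕ → Triangle κ} (ht : IsNested t) (h0 : ∀ v ∈ (t 0).vertices, m ≤ ⟪u, v.toSphere⟫)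
    (N : ℕ) : ∑ i ∈ Finset.range N, (t i).distortion ≤
      (t 0).sideMax (gnomonicDist u) ^ 2 / (4 * m ^ 2) / (1 - (1 + m)⁻¹ ^ 2) := by
  have hθ : (1 + m)⁻¹ < 1 := inv_lt_one_of_one_lt₀ (by linarith)
  have hstep (n : ℕ) : (t (n + 1)).sideMax (gnomonicDist u) ^ 2 / (4 * m ^ 2) ≤
      (1 + m)⁻¹ ^ 2 * ((t n).sideMax (gnomonicDist u) ^ 2 / (4 * m ^ 2)) := by
    obtain ⟨k, hk⟩ := ht n
    rw [← mul_div_assoc, ← mul_pow]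
    gcongr
    · exact (t (n + 1)).sideMax_gnomonicDist_nonneg u
    · exact hk.sideMax_gnomonicDist_le hκ hu hm (ht.le_inner_toSphere hκ hm h0 n)
  exact (Finset.sum_le_sum fun i _ =>
    (t i).distortion_le_gnomonicDist hκ hu hm (ht.le_inner_toSphere hκ hm h0 i)).trans <|
      sum_range_le_div_one_sub (a := fun n => (t n).sideMax (gnomonicDist u) ^ 2 / (4 * m ^ 2))
        (by positivity) (by positivity) (pow_lt_one₀ (by positivity) hθ two_ne_zero) hstep N

end PosCurvature

section SmallTriangles

theorem tendsto_maxSide : Tendsto Triangle.maxSide (sidesToZero κ) (𝓝 0) := tendsto_comap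

theorem tendsto_sideMax_comp_gdist {φ : ℝ → ℝ} (hφ : ContinuousAt φ 0) :
    Tendsto (Triangle.sideMax fun p q => φ (gdist p q)) (sidesToZero κ) (𝓝 (φ 0)) := by
  have ha : Tendsto Triangle.a (sidesToZero κ) (𝓝 0) :=
    squeeze_zero (fun T => gdist_nonneg _ _) (fun T => le_max_left _ _) tendsto_maxSide
  have hb : Tendsto Triangle.b (sidesToZero κ) (𝓝 0) :=
    squeeze_zero (fun T => gdist_nonneg _ _) (fun T => (le_max_left _ _).trans (le_max_right _ _))
      tendsto_maxSide
  have hc : Tendsto Triangle.c (sidesToZero κ) (𝓝 0) :=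
    squeeze_zero (fun T => gdist_nonneg _ _) (fun T => (le_max_right _ _).trans (le_max_right _ _))
      tendsto_maxSide
  have h := (hφ.tendsto.comp ha).max ((hφ.tendsto.comp hb).max (hφ.tendsto.comp hc))
  rwa [max_self, max_self] at h

theorem tendsto_distortion : Tendsto Triangle.distortion (sidesToZero κ) (𝓝 0) := by
  have hφ : ContinuousAt (fun t => |Real.log ((1 + modelCos κ t) / 2)|) 0 := by
    have hcos := (continuous_modelCos (κ := κ)).continuousAt (x := 0)
    have hne : (1 + modelCos κ 0) / 2 ≠ 0 := by rw [modelCos_zero_right]; norm_num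
    exact (((continuousAt_const.add hcos).div_const 2).log hne).abs
  have h := tendsto_sideMax_comp_gdist (κ := κ) hφ
  simp only [modelCos_gdist, modelCos_zero_right, add_self_div_two, Real.log_one, abs_zero] at h
  exact h

/-- The largest value of `1 - modelCos κ s` over the sides `s` of a triangle. -/
def Triangle.defect (T : Triangle κ) : ℝ := T.sideMax fun p q => 1 - form κ p.vec q.vec

theorem tendsto_defect : Tendsto Triangle.defect (sidesToZero κ) (𝓝 0) := by
  have hφ : ContinuousAt (fun t => 1 - modelCos κ t) 0 := by
    have := continuous_modelCos (κ := κ)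
    fun_prop
  have h := tendsto_sideMax_comp_gdist (κ := κ) hφ
  simp only [modelCos_gdist, modelCos_zero_right, sub_self] at h
  exact h

theorem Triangle.one_sub_form_le_defect (hκ : 0 < κ) (T : Triangle κ) :
    ∀ p ∈ T.vertices, ∀ q ∈ T.vertices, 1 - form κ p.vec q.vec ≤ T.defect := by
  refine le_sideMax (fun p q => by rw [form_comm]) fun p => ?_
  rw [p.form_self, sub_self]
  exact le_max_of_le_left (by linarith [(abs_le.1 (abs_form_le_one hκ T.B T.C)).2])

theorem Triangle.defect_nonneg (hκ : 0 < κ) (T : Triangle κ) : 0 ≤ T.defect := by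
  simpa only [T.A.form_self, sub_self] using
    T.one_sub_form_le_defect hκ _ T.A_mem_vertices _ T.A_mem_vertices

open scoped RealInnerProductSpace in
theorem Triangle.sideMax_gnomonicDist_sq_le (hκ : 0 < κ) {u : EuclideanSpace ℝ (Fin 3)} {m : ℝ}
    (hu : ‖u‖ = 1) (hm : 0 < m) {T : Triangle κ} (hT : ∀ v ∈ T.vertices, m ≤ ⟪u, v.toSphere⟫) :
    T.sideMax (gnomonicDist u) ^ 2 ≤ 4 * T.defect / m ^ 4 := by
  have hle : ∀ p ∈ T.vertices, ∀ q ∈ T.vertices, gnomonicDist u p q ≤ √(4 * T.defect / m ^ 4) := by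
    intro p hp q hq
    refine Real.le_sqrt_of_sq_le ((dist_gnomonic_sq_le hu (norm_toSphere hκ.le p)
      (norm_toSphere hκ.le q) hm (hT p hp) (hT q hq)).trans ?_)
    rw [inner_toSphere hκ.le]
    gcongr
    exact T.one_sub_form_le_defect hκ p hp q hq
  have hmax : T.sideMax (gnomonicDist u) ≤ √(4 * T.defect / m ^ 4) :=
    max_le (hle _ T.B_mem_vertices _ T.C_mem_vertices) (max_le
      (hle _ T.C_mem_vertices _ T.A_mem_vertices) (hle _ T.A_mem_vertices _ T.B_mem_vertices))
  have hdefect := T.defect_nonneg hκ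
  exact (Real.le_sqrt (T.sideMax_gnomonicDist_nonneg u) (by positivity)).1 hmax

theorem Triangle.totalDistortion_le_defect (hκ : 0 < κ) {T : Triangle κ}
    (hT : T.defect ≤ 1 / 2) : T.totalDistortion ≤ 576 / 5 * T.defect := by
  have hcenter : ∀ v ∈ T.vertices, (1 / 2 : ℝ) ≤ inner ℝ T.A.toSphere v.toSphere := by
    intro v hv
    rw [inner_toSphere hκ.le]
    linarith [T.one_sub_form_le_defect hκ _ T.A_mem_vertices v hv]
  have hu := norm_toSphere hκ.le T.A
  have hD := T.sideMax_gnomonicDist_sq_le hκ hu one_half_pos hcenter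
  refine totalDistortion_le (mul_nonneg (by norm_num) (T.defect_nonneg hκ)) ?_
  rintro t ht rfl N
  have hsum := ht.sum_distortion_le_of_pos hκ hu one_half_pos hcenter N
  norm_num at hD hsum
  linarith

theorem IsNested.sum_distortion_le {t : ℕ → Triangle κ} (ht : IsNested t) (N : ℕ) :
    ∑ i ∈ Finset.range N, (t i).distortion ≤ (t 0).totalDistortion := by
  rcases le_or_gt κ 0 with hκ | hκ
  · refine ht.sum_distortion_le_totalDistortion (C := 2 * (t 0).distortion) (fun s hs h0 N => ?_) N
    exact h0 ▸ hs.sum_distortion_le_of_nonpos hκ N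
  · obtain ⟨u, hu, m, hm, hcenter⟩ := (t 0).exists_center hκ
    exact ht.sum_distortion_le_totalDistortion
      (fun s hs h0 => h0 ▸ hs.sum_distortion_le_of_pos hκ hu hm (h0 ▸ hcenter)) N

theorem tendsto_totalDistortion :
    Tendsto Triangle.totalDistortion (sidesToZero κ) (𝓝 0) := by
  rcases le_or_gt κ 0 with hκ | hκ
  · refine squeeze_zero Triangle.totalDistortion_nonneg (fun T => ?_)
      (by simpa only [mul_zero] using tendsto_distortion.const_mul 2)
    refine Triangle.totalDistortion_le (mul_nonneg zero_le_two T.distortion_nonneg) ?_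
    rintro t ht rfl N
    exact ht.sum_distortion_le_of_nonpos hκ N
  · refine squeeze_zero' (.of_forall Triangle.totalDistortion_nonneg) ?_
      (by simpa only [mul_zero] using tendsto_defect.const_mul (576 / 5))
    filter_upwards [tendsto_defect.eventually_le_const one_half_pos] with T hT
    exact T.totalDistortion_le_defect hκ hT

end SmallTriangles

section Distortion

/-- Three times the total distortion bounds `|log (2 ^ n * hₙ / h₀)|`; the summand `maxSide` makes
this bound strict. -/
def Triangle.logBound (T : Triangle κ) : ℝ := 3 * T.totalDistortion + T.maxSide

theorem Triangle.logBound_pos (T : Triangle κ) : 0 < T.logBound :=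
  add_pos_of_nonneg_of_pos (mul_nonneg zero_le_three T.totalDistortion_nonneg) T.maxSide_pos

theorem tendsto_logBound : Tendsto Triangle.logBound (sidesToZero κ) (𝓝 0) := by
  have h := (tendsto_totalDistortion (κ := κ).const_mul 3).add tendsto_maxSide
  rwa [mul_zero, add_zero] at h

theorem IsNested.abs_log_height_sub_lt {t : ℕ → Triangle κ} (ht : IsNested t) (n : ℕ) :
    |Real.log (2 ^ n * (t n).height) - Real.log (t 0).height| < (t 0).logBound :=
  calc |Real.log (2 ^ n * (t n).height) - Real.log (t 0).height|
      ≤ 3 * ∑ i ∈ Finset.range (n + 1), (t i).distortion := ht.abs_log_height_sub_le n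
    _ ≤ 3 * (t 0).totalDistortion := by gcongr; exact ht.sum_distortion_le (n + 1)
    _ < (t 0).logBound := lt_add_of_pos_right _ (t 0).maxSide_pos

theorem mul_exp_lt_of_abs_log_sub_lt {x y δ : ℝ} (hx : 0 < x) (hy : 0 < y)
    (h : |Real.log y - Real.log x| < δ) :
    x * Real.exp (-δ) < y ∧ y < x * Real.exp δ := by
  obtain ⟨h1, h2⟩ := abs_lt.1 h
  nth_rw 1 2 [← Real.exp_log hx]
  nth_rw 1 2 [← Real.exp_log hy]
  rw [← Real.exp_add, ← Real.exp_add, Real.exp_lt_exp, Real.exp_lt_exp]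
  constructor <;> linarith

end Distortion

end MedialSubdivision

end

open MedialSubdivision in
theorem proposition4p1_general (κ : ℝ) :
    ∃ l L : Triangle κ → ℝ,
      (∀ T, 0 < l T ∧ 0 < L T) ∧
      (∀ t : ℕ → Triangle κ, IsNested t → ∀ n : ℕ,
        (t 0).height * l (t 0) < 2 ^ n * (t n).height ∧
          2 ^ n * (t n).height < (t 0).height * L (t 0)) ∧
      Tendsto l (sidesToZero κ) (𝓝[<] 1) ∧
      Tendsto L (sidesToZero κ) (𝓝[>] 1) := by
  refine ⟨fun T => Real.exp (-T.logBound), fun T => Real.exp T.logBound,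
    fun T => ⟨Real.exp_pos _, Real.exp_pos _⟩, fun t ht n => ?_, ?_, ?_⟩
  · exact mul_exp_lt_of_abs_log_sub_lt (t 0).height_pos (mul_pos (by positivity) (t n).height_pos)
      (ht.abs_log_height_sub_lt n)
  · have h := (Real.continuous_exp.tendsto _).comp (tendsto_logBound (κ := κ)).neg
    rw [neg_zero, Real.exp_zero] at h
    exact tendsto_nhdsWithin_iff.2
      ⟨h, .of_forall fun T => Real.exp_lt_one_iff.2 (neg_neg_of_pos T.logBound_pos)⟩
  · have h := (Real.continuous_exp.tendsto _).comp (tendsto_logBound (κ := κ))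
    rw [Real.exp_zero] at h
    exact tendsto_nhdsWithin_iff.2
      ⟨h, .of_forall fun T => Real.one_lt_exp_iff.2 T.logBound_pos⟩

theorem proposition4p1 (κ : ℝ) :
    ∃ l L : MedialSubdivision.Triangle κ → ℝ,
      (∀ T, 0 < l T ∧ 0 < L T) ∧
      (∀ t : ℕ → MedialSubdivision.Triangle κ, MedialSubdivision.IsNested t →
        (∀ n : ℕ,
          (t 0).height * l (t 0) ≤ 2 ^ n * (t n).height ∧
            2 ^ n * (t n).height ≤ (t 0).height * L (t 0)) ∧
        ((∃ m : ℕ, MedialSubdivision.ParallelSideA (t m) (t (m + 1))) →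
          ∀ n : ℕ,
            (t 0).height * l (t 0) < 2 ^ n * (t n).height ∧
              2 ^ n * (t n).height < (t 0).height * L (t 0))) ∧
      Tendsto l (MedialSubdivision.sidesToZero κ) (𝓝[<] 1) ∧
      Tendsto L (MedialSubdivision.sidesToZero κ) (𝓝[>] 1) := by
  obtain ⟨l, L, hpos, hstrict, hl, hL⟩ := proposition4p1_general κ
  exact ⟨l, L, hpos, fun t ht =>
    ⟨fun n => (hstrict t ht n).imp le_of_lt le_of_lt, fun _ => hstrict t ht⟩, hl, hL⟩
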